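/- Let $n,p,r$ be integers with $1\le r\le n-5$ and $r<p$. Let $X_1,\dots,X_n$ be independent random vectors with the (singular) normal distribution $N_p(\mu,\Sigma)$, where $\mu\in\mathbb R^p$ is arbitrary and $\Sigma$ is a $p\times p$ positive semidefinite matrix of rank $r$; both are unknown. Put $$\bar X=\frac1n\sum_{i=1}^nX_i,\qquad S=\frac1n\sum_{i=1}^n(X_i-\bar X)(X_i-\bar X)^t,\qquad \eta=\Sigma^+\mu,$$ where $A^+$ denotes the Moore-Penrose pseudoinverse of $A$, and let the risk of an estimator $\hat\eta$ of $\eta$ be $\mathrm E\|\hat\eta-\eta\|_2^2$. Then, for all such $(\mu,\Sigma)$, the risk of $aS^+\bar X$ is finite for every $a\in\mathbb R$, $\mathrm E(\bar X^tS^{+2}\bar X)<\infty$, and for every real $a\le\frac{n-r-2}n$ $$\mathrm E\big\|aS^+\bar X-\eta\big\|_2^2\le \mathrm E\Big\|\frac{n-r-2}nS^+\bar X-\eta\Big\|_2^2+\Big(a-\frac{n-r-2}n\Big)\Big(a-\frac{n-r-4}n\Big)\mathrm E\big(\bar X^tS^{+2}\bar X\big).$$ The right-hand side, as a function of $a\in\mathbb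 R$, has the unique minimizer $a=\frac{n-r-3}n$. The corresponding estimator $\hat\eta_{\mathrm{TK1}}=\frac{n-r-3}nS^+\bar X$ dominates $\frac{n-r-2}nS^+\bar X$, which itself dominates $S^+\bar X$. (An estimator dominates another if its risk is at most that of the other for every $(\mu,\Sigma)$ with $\Sigma$ positive semidefinite of rank $r$, and smaller for at least one such $(\mu,\Sigma)$.) -/

import Mathlib

open MeasureTheory ProbabilityTheory
open scoped Matrix

noncomputable section

namespace SingularNormal

/-! ### The Moore-Penrose pseudoinverse of a real matrix -/

/-- The four Penrose equations: `B` is a Moore-Penrose pseudoinverse of the real matrix `A`. -/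
structure IsMoorePenrose {m n : Type*} [Fintype m] [Fintype n]
    (A : Matrix m n ℝ) (B : Matrix n m ℝ) : Prop where
  mul_mul_left : A * B * A = A
  mul_mul_right : B * A * B = B
  symm_left : (A * B)ᵀ = A * B
  symm_right : (B * A)ᵀ = B * A

theorem IsMoorePenrose.unique {m n : Type*} [Fintype m] [Fintype n]
    {A : Matrix m n ℝ} {B C : Matrix n m ℝ}
    (hB : IsMoorePenrose A B) (hC : IsMoorePenrose A C) : B = C := by
  have h1 : A * B = A * C := by
    calc A * B = (A * B)ᵀ := hB.symm_left.symm
      _ = ((A * C) * (A * B))ᵀ := by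
          rw [← Matrix.mul_assoc (A * C), hC.mul_mul_left]
      _ = (A * B) * (A * C) := by
          rw [Matrix.transpose_mul, hB.symm_left, hC.symm_left]
      _ = A * C := by rw [← Matrix.mul_assoc (A * B), hB.mul_mul_left]
  have h2 : B * A = C * A := by
    calc B * A = (B * A)ᵀ := hB.symm_right.symm
      _ = ((B * A) * (C * A))ᵀ := by
          rw [Matrix.mul_assoc B A, ← Matrix.mul_assoc A C A, hC.mul_mul_left]
      _ = (C * A) * (B * A) := by
          rw [Matrix.transpose_mul, hB.symm_right, hC.symm_right]
      _ = C * A := by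
          rw [Matrix.mul_assoc C A, ← Matrix.mul_assoc A B A, hB.mul_mul_left]
  calc B = B * A * B := hB.mul_mul_right.symm
    _ = C * (A * B) := by rw [h2, Matrix.mul_assoc]
    _ = C * A * C := by rw [h1, Matrix.mul_assoc]
    _ = C := hC.mul_mul_right

/-- A real symmetric matrix has a symmetric pseudoinverse: invert the non-zero eigenvalues. -/
theorem exists_isMoorePenrose_of_isHermitian {n : Type*} [Fintype n]
    {G : Matrix n n ℝ} (hG : G.IsHermitian) :
    ∃ H : Matrix n n ℝ, Hᵀ = H ∧ IsMoorePenrose G H := by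
  classical
  obtain ⟨U, d, hU, hGU⟩ : ∃ (U : Matrix n n ℝ) (d : n → ℝ),
      Uᵀ * U = 1 ∧ G = U * Matrix.diagonal d * Uᵀ := by
    refine ⟨hG.eigenvectorUnitary, hG.eigenvalues, ?_, ?_⟩
    · have := Unitary.coe_star_mul_self hG.eigenvectorUnitary
      rwa [Matrix.star_eq_conjTranspose, Matrix.conjTranspose_eq_transpose_of_trivial] at this
    · have := hG.spectral_theorem
      rw [Unitary.conjStarAlgAut_apply, Matrix.star_eq_conjTranspose,
        Matrix.conjTranspose_eq_transpose_of_trivial] at this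
      simpa [Function.comp_def] using this
  have key : ∀ v w : n → ℝ, (U * Matrix.diagonal v * Uᵀ) * (U * Matrix.diagonal w * Uᵀ)
      = U * Matrix.diagonal (fun i => v i * w i) * Uᵀ := by
    intro v w
    calc _ = U * Matrix.diagonal v * (Uᵀ * U) * Matrix.diagonal w * Uᵀ := by
          simp only [Matrix.mul_assoc]
      _ = _ := by
          rw [hU, Matrix.mul_one, Matrix.mul_assoc U, Matrix.diagonal_mul_diagonal]
  have symm : ∀ v : n → ℝ, (U * Matrix.diagonal v * Uᵀ)ᵀ = U * Matrix.diagonal v * Uᵀ := by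
    intro v
    simp [Matrix.transpose_mul, Matrix.mul_assoc]
  refine ⟨U * Matrix.diagonal (fun i => (d i)⁻¹) * Uᵀ, symm _, ?_, ?_, ?_, ?_⟩
  · rw [hGU, key, key]
    simp [mul_inv_mul_cancel]
  · rw [hGU, key, key]
    congr 3
    funext i
    simpa using mul_inv_mul_cancel (d i)⁻¹
  · rw [hGU, key, symm]
  · rw [hGU, key, symm]

theorem exists_isMoorePenrose {m n : Type*} [Fintype m] [Fintype n] (A : Matrix m n ℝ) :
    ∃ B : Matrix n m ℝ, IsMoorePenrose A B := by
  have hG : (Aᵀ * A).IsHermitian := by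
    simpa using Matrix.isHermitian_conjTranspose_mul_self A
  obtain ⟨H, hHs, hH⟩ := exists_isMoorePenrose_of_isHermitian hG
  have h1 : H * (Aᵀ * A) = Aᵀ * A * H := by
    have := hH.symm_right
    rw [Matrix.transpose_mul, hHs, Matrix.transpose_mul, Matrix.transpose_transpose] at this
    exact this.symm
  have h2 : A * (H * (Aᵀ * A)) = A := by
    have h0 : (A * (H * (Aᵀ * A)) - A)ᵀ * (A * (H * (Aᵀ * A)) - A) = 0 := by
      have e : Aᵀ * (A * (H * (Aᵀ * A)) - A) = 0 := by
        rw [Matrix.mul_sub, ← Matrix.mul_assoc Aᵀ A, ← Matrix.mul_assoc (Aᵀ * A) H,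
          hH.mul_mul_left, sub_self]
      have e' : (A * (H * (Aᵀ * A)) - A)ᵀ = (H * (Aᵀ * A)) ᵀ * Aᵀ - Aᵀ := by
        rw [Matrix.transpose_sub, Matrix.transpose_mul A]
      rw [e', Matrix.sub_mul, Matrix.mul_assoc, e, Matrix.mul_zero, sub_zero]
    have h0' : (A * (H * (Aᵀ * A)) - A)ᴴ * (A * (H * (Aᵀ * A)) - A) = 0 := by
      rwa [Matrix.conjTranspose_eq_transpose_of_trivial]
    exact sub_eq_zero.mp (Matrix.conjTranspose_mul_self_eq_zero.mp h0')
  refine ⟨H * Aᵀ, ?_, ?_, ?_, ?_⟩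
  · simpa only [Matrix.mul_assoc] using h2
  · have := hH.mul_mul_right
    calc H * Aᵀ * A * (H * Aᵀ) = H * (Aᵀ * A) * H * Aᵀ := by simp only [Matrix.mul_assoc]
      _ = H * Aᵀ := by rw [this]
  · simp [Matrix.transpose_mul, hHs, Matrix.mul_assoc]
  · rw [Matrix.mul_assoc]
    exact hH.symm_right

/-- The Moore-Penrose pseudoinverse `A⁺` of a real matrix. -/
def pinv {m n : Type*} [Fintype m] [Fintype n] (A : Matrix m n ℝ) : Matrix n m ℝ :=
  Classical.choose (exists_isMoorePenrose A)

theorem isMoorePenrose_pinv {m n : Type*} [Fintype m] [Fintype n] (A : Matrix m n ℝ) :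
    IsMoorePenrose A (pinv A) :=
  Classical.choose_spec (exists_isMoorePenrose A)

/-! ### The model -/

/-- The parameters `(μ, Σ)` of the model: an arbitrary mean and a `p × p` covariance matrix
of rank `r`. -/
structure Param (p r : ℕ) where
  mean : EuclideanSpace ℝ (Fin p)
  cov : Matrix (Fin p) (Fin p) ℝ
  posSemidef : cov.PosSemidef
  rank_eq : cov.rank = r

/-- A sample `X₁, …, Xₙ` of `n` vectors of `ℝᵖ`. -/
abbrev Sample (n p : ℕ) : Type := Fin n → EuclideanSpace ℝ (Fin p)

/-- The law of a sample `X₁, …, Xₙ` of independent vectors with distribution `N_p(μ, Σ)`. -/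
def sampleLaw (n : ℕ) {p r : ℕ} (θ : Param p r) : Measure (Sample n p) :=
  Measure.pi fun _ => multivariateGaussian θ.mean θ.cov

/-- The sample mean `X̄`. -/
def sampleMean {n p : ℕ} (X : Sample n p) : EuclideanSpace ℝ (Fin p) :=
  (n : ℝ)⁻¹ • ∑ i, X i

/-- The centred `n × p` data matrix, with rows `(Xᵢ - X̄)ᵗ`. -/
def centredData {n p : ℕ} (X : Sample n p) : Matrix (Fin n) (Fin p) ℝ :=
  Matrix.of fun i j => X i j - sampleMean X j

/-- The sample covariance matrix `S`, normalised by `n`. -/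
def sampleCov {n p : ℕ} (X : Sample n p) : Matrix (Fin p) (Fin p) ℝ :=
  (n : ℝ)⁻¹ • ((centredData X)ᵀ * centredData X)

/-! ### Estimation of the discriminant coefficients -/

/-- The discriminant coefficients `η = Σ⁺ μ`. -/
def discCoef {p r : ℕ} (θ : Param p r) : EuclideanSpace ℝ (Fin p) :=
  WithLp.toLp 2 (pinv θ.cov *ᵥ θ.mean.ofLp)

/-- The estimator `a S⁺ X̄`. -/
def scaledEstimator {n p : ℕ} (a : ℝ) (X : Sample n p) : EuclideanSpace ℝ (Fin p) :=
  a • WithLp.toLp 2 (pinv (sampleCov X) *ᵥ (sampleMean X).ofLp)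

/-- The square loss `‖η̂ - η‖²` of the estimator `δ`, at the sample `X`. -/
def sqLoss {n p r : ℕ} (δ : Sample n p → EuclideanSpace ℝ (Fin p)) (θ : Param p r)
    (X : Sample n p) : ℝ :=
  ‖δ X - discCoef θ‖ ^ 2

/-- The risk `E ‖η̂ - η‖²` of the estimator `δ`. -/
def risk {n p r : ℕ} (δ : Sample n p → EuclideanSpace ℝ (Fin p)) (θ : Param p r) : ℝ :=
  ∫ X, sqLoss δ θ X ∂(sampleLaw n θ)

/-- The quadratic form `X̄ᵗ (S⁺)² X̄`. -/
def quadForm {n p : ℕ} (X : Sample n p) : ℝ :=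
  (sampleMean X).ofLp ⬝ᵥ ((pinv (sampleCov X) ^ 2) *ᵥ (sampleMean X).ofLp)

/-- The upper bound on the risk of `a S⁺ X̄`, as a function of `a`. -/
def riskBound (n : ℕ) {p r : ℕ} (θ : Param p r) (a : ℝ) : ℝ :=
  risk (n := n) (scaledEstimator (((n : ℝ) - r - 2) / n)) θ +
    (a - ((n : ℝ) - r - 2) / n) * (a - ((n : ℝ) - r - 4) / n) *
      ∫ X, quadForm X ∂(sampleLaw n θ)

/-- `δ₁` dominates `δ₂` in the model with covariance of rank `r`: its risk is nowhere larger, and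
it is smaller at some parameter. -/
def Dominates {n p : ℕ} (r : ℕ) (δ₁ δ₂ : Sample n p → EuclideanSpace ℝ (Fin p)) : Prop :=
  (∀ θ : Param p r, risk δ₁ θ ≤ risk δ₂ θ) ∧ ∃ θ : Param p r, risk δ₁ θ < risk δ₂ θ

end SingularNormal

end

open SingularNormal

/-! Choose a full rank factorisation `Σ = A Aᵗ` with `Aᵗ A = D` diagonal, and write each observation
as `μ + A z` with `z` standard Gaussian in `ℝʳ`. Read across the sample, the noise consists of `r`
independent standard Gaussian vectors of `ℝⁿ`. Split each along the unit diagonal vector and its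
orthogonal complement `E`, of dimension `n - 1`. The components `y` along the diagonal give `X̄ = μ
+ n^(-1/2) A y`; the components `c` in `E` give `S = n⁻¹ A G Aᵗ` with `G` the Gram matrix of `c`, a
Wishart matrix independent of `y`. Almost surely `G` is invertible and `S⁺ = n A D⁻¹ G⁻¹ D⁻¹ Aᵗ`.

With `ν = D⁻¹ Aᵗ μ` and `L = G⁻¹ (ν + n^(-1/2) y)`, the loss of `a S⁺ X̄` is `∑ⱼ dⱼ⁻¹ (a n Lⱼ -
νⱼ)²`, so only the first two moments of `Lⱼ` matter. Flipping the sign of `yⱼ` and `cⱼ` preserves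
the law, and the average of `Lⱼ` with its flipped version is `νⱼ (G⁻¹)ⱼⱼ`. Hence `E Lⱼ = νⱼ E
(G⁻¹)ⱼⱼ`, and by convexity `E Lⱼ² ≥ νⱼ² E (G⁻¹)ⱼⱼ²`. Finally `(G⁻¹)ⱼⱼ` is the inverse squared
distance of `cⱼ` to the span of the other vectors, thus the inverse of a chi-square variable with `n
- r` degrees of freedom. Its first two moments are `1/(n-r-2)` and `1/((n-r-2)(n-r-4))`; the second
is finite because `n - r ≥ 5`.

Put `k = n - r - 2`. The risk is `(an)² Q - 2 (an) s/k + s` with `Q > 0` and `s/k ≤ (k - 2) Q`. All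
the claims are elementary inequalities about this quadratic; they need only `s/k ≤ (k - 1) Q`. -/

/-! ### Inverse moments of chi-square variables -/

open Set Filter Topology in
theorem hasDerivAt_one_add_two_mul_rpow {s t : ℝ} (hs : 1 < s) (ht : 0 ≤ t) :
    HasDerivAt (fun t : ℝ => -(1 + 2 * t) ^ (1 - s) / (2 * (s - 1))) ((1 + 2 * t) ^ (-s)) t := by
  have h1 : HasDerivAt (fun t : ℝ => 1 + 2 * t) 2 t := by
    simpa using ((hasDerivAt_id t).const_mul 2).const_add 1
  have h2 := ((h1.rpow_const (p := 1 - s) (Or.inl (by positivity))).neg).div_const (2 * (s - 1))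
  have : s - 1 ≠ 0 := by linarith
  have e : -(2 * (1 - s) * (1 + 2 * t) ^ (1 - s - 1)) / (2 * (s - 1)) = (1 + 2 * t) ^ (-s) := by
    rw [show 1 - s - 1 = -s by ring]
    field_simp
    ring
  rw [e] at h2
  exact h2

open Set Filter Topology in
theorem tendsto_one_add_two_mul_rpow {s : ℝ} (hs : 1 < s) :
    Tendsto (fun t : ℝ => -(1 + 2 * t) ^ (1 - s) / (2 * (s - 1))) atTop (𝓝 0) := by
  have h0 : Tendsto (fun t : ℝ => 1 + 2 * t) atTop atTop :=
    tendsto_atTop_add_const_left _ _ (tendsto_id.const_mul_atTop (by norm_num))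
  have h1 := (tendsto_rpow_neg_atTop (show 0 < s - 1 by linarith)).comp h0
  have h2 := (h1.neg).div_const (2 * (s - 1))
  simpa [Function.comp_def] using h2

open Set in
theorem integrableOn_one_add_two_mul_rpow {s : ℝ} (hs : 1 < s) :
    IntegrableOn (fun t : ℝ => (1 + 2 * t) ^ (-s)) (Ioi 0) :=
  integrableOn_Ioi_deriv_of_nonneg' (fun t ht => hasDerivAt_one_add_two_mul_rpow hs ht)
    (fun t ht => by have : (0 : ℝ) < t := ht; positivity) (tendsto_one_add_two_mul_rpow hs)

open Set in
theorem integral_one_add_two_mul_rpow {s : ℝ} (hs : 1 < s) :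
    ∫ t in Ioi (0 : ℝ), (1 + 2 * t) ^ (-s) = 1 / (2 * (s - 1)) := by
  rw [integral_Ioi_of_hasDerivAt_of_tendsto' (fun t ht => hasDerivAt_one_add_two_mul_rpow hs ht)
    (integrableOn_one_add_two_mul_rpow hs) (tendsto_one_add_two_mul_rpow hs)]
  simp [neg_div]

open Set in
theorem lintegral_one_add_two_mul_rpow {s : ℝ} (hs : 1 < s) :
    ∫⁻ t in Ioi (0 : ℝ), ENNReal.ofReal ((1 + 2 * t) ^ (-s)) =
      ENNReal.ofReal (1 / (2 * (s - 1))) := by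
  rw [← integral_one_add_two_mul_rpow hs,
    ofReal_integral_eq_lintegral_ofReal (integrableOn_one_add_two_mul_rpow hs)]
  filter_upwards [ae_restrict_mem measurableSet_Ioi] with t ht
  have : (0 : ℝ) < t := ht
  show (0 : ℝ) ≤ (1 + 2 * t) ^ (-s)
  positivity

open Set in
theorem lintegral_mul_one_add_two_mul_rpow {s : ℝ} (hs : 2 < s) :
    ∫⁻ t in Ioi (0 : ℝ), ENNReal.ofReal (t * (1 + 2 * t) ^ (-s)) =
      ENNReal.ofReal (1 / (4 * (s - 1) * (s - 2))) := by
  have h1 := integrableOn_one_add_two_mul_rpow (s := s) (by linarith)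
  have h2 := integrableOn_one_add_two_mul_rpow (s := s - 1) (by linarith)
  have e : ∀ t ∈ Ioi (0 : ℝ), t * (1 + 2 * t) ^ (-s) =
      (1 / 2) * ((1 + 2 * t) ^ (-(s - 1)) - (1 + 2 * t) ^ (-s)) := by
    intro t ht
    have ht' : (0 : ℝ) < t := ht
    rw [show -(s - 1) = -s + 1 by ring, Real.rpow_add_one (by positivity)]
    ring
  have hint : IntegrableOn (fun t : ℝ => t * (1 + 2 * t) ^ (-s)) (Ioi 0) :=
    IntegrableOn.congr_fun ((h2.sub h1).const_mul (1 / 2)) (fun t ht => (e t ht).symm) measurableSet_Ioi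
  have hval : ∫ t in Ioi (0 : ℝ), t * (1 + 2 * t) ^ (-s) = 1 / (4 * (s - 1) * (s - 2)) := by
    rw [setIntegral_congr_fun measurableSet_Ioi e, integral_const_mul, integral_sub h2 h1,
      integral_one_add_two_mul_rpow (by linarith), integral_one_add_two_mul_rpow (by linarith)]
    have : s - 1 ≠ 0 := by linarith
    have : s - 2 ≠ 0 := by linarith
    have : s - 1 - 1 ≠ 0 := by intro h; apply this; linarith
    field_simp
    ring
  rw [← hval, ofReal_integral_eq_lintegral_ofReal hint]
  filter_upwards [ae_restrict_mem measurableSet_Ioi] with t ht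
  have : (0 : ℝ) < t := ht
  show (0 : ℝ) ≤ t * (1 + 2 * t) ^ (-s)
  positivity

open Set in
-- Writing inverse powers as integrals of exponentials reduces inverse moments, by Tonelli, to
-- integrals of a Laplace transform.
theorem lintegral_exp_neg_mul_Ioi {s : ℝ} (hs : 0 < s) :
    ∫⁻ t in Ioi (0 : ℝ), ENNReal.ofReal (Real.exp (-t * s)) = ENNReal.ofReal s⁻¹ := by
  have h := integral_exp_mul_Ioi (a := -s) (by linarith) 0
  have h' : ∫ t in Ioi (0 : ℝ), Real.exp (-t * s) = s⁻¹ := by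
    rw [show (fun t : ℝ => Real.exp (-t * s)) = fun t => Real.exp (-s * t) by
      funext t; congr 1; ring, h]
    simp
  have hint : IntegrableOn (fun t : ℝ => Real.exp (-t * s)) (Ioi 0) := by
    apply Integrable.of_integral_ne_zero
    rw [h']; positivity
  rw [← h', ofReal_integral_eq_lintegral_ofReal hint]
  exact Filter.Eventually.of_forall fun t => (Real.exp_pos _).le

open Set in
theorem lintegral_mul_exp_neg_mul_Ioi {s : ℝ} (hs : 0 < s) :
    ∫⁻ t in Ioi (0 : ℝ), ENNReal.ofReal (t * Real.exp (-t * s)) = ENNReal.ofReal (s⁻¹ ^ 2) := by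
  have h := Real.integral_rpow_mul_exp_neg_mul_Ioi (a := 2) (r := s) (by norm_num) hs
  have h' : ∫ t in Ioi (0 : ℝ), t * Real.exp (-t * s) = s⁻¹ ^ 2 := by
    rw [show (fun t : ℝ => t * Real.exp (-t * s)) =
      fun t => t ^ ((2 : ℝ) - 1) * Real.exp (-(s * t)) by
        funext t; rw [show (2 : ℝ) - 1 = 1 by norm_num, Real.rpow_one]; congr 2; ring, h]
    simp
  have hint : IntegrableOn (fun t : ℝ => t * Real.exp (-t * s)) (Ioi 0) := by
    apply Integrable.of_integral_ne_zero
    rw [h']; positivity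
  rw [← h', ofReal_integral_eq_lintegral_ofReal hint]
  filter_upwards [ae_restrict_mem measurableSet_Ioi] with t ht
  exact mul_nonneg (le_of_lt ht) (Real.exp_pos _).le

theorem integral_exp_neg_mul_sq_gaussianReal {t : ℝ} (ht : 0 ≤ t) :
    ∫ x, Real.exp (-t * x ^ 2) ∂(gaussianReal 0 1) = (1 + 2 * t) ^ (-(1 / 2) : ℝ) := by
  rw [integral_gaussianReal_eq_integral_smul (by simp)]
  have e : ∀ x : ℝ, gaussianPDFReal 0 1 x • Real.exp (-t * x ^ 2) =
      (√(2 * Real.pi))⁻¹ * Real.exp (-(t + 1 / 2) * x ^ 2) := by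
    intro x
    simp only [gaussianPDFReal, NNReal.coe_one, mul_one, sub_zero, smul_eq_mul]
    rw [mul_assoc, ← Real.exp_add]
    congr 2
    ring
  simp_rw [e]
  rw [integral_const_mul, integral_gaussian, ← Real.sqrt_inv, ← Real.sqrt_mul (by positivity),
    Real.rpow_neg (by positivity), ← Real.sqrt_eq_rpow, ← Real.sqrt_inv]
  congr 1
  have := Real.pi_pos
  field_simp
  ring

section
variable {E : Type*} [NormedAddCommGroup E] [InnerProductSpace ℝ E] [FiniteDimensional ℝ E]
  [MeasurableSpace E] [BorelSpace E]

/-- The coordinates in an orthonormal basis are independent standard normal, so the exponential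
factors. This is the Laplace transform of a chi-square variable. -/
theorem integral_exp_neg_mul_norm_sq_stdGaussian {t : ℝ} (ht : 0 ≤ t) :
    ∫ x, Real.exp (-t * ‖x‖ ^ 2) ∂(stdGaussian E) =
      (1 + 2 * t) ^ (-(Module.finrank ℝ E / 2) : ℝ) := by
  rw [stdGaussian, integral_map (Measurable.aemeasurable (by fun_prop))
    (Measurable.aestronglyMeasurable (by fun_prop))]
  have e : ∀ x : Fin (Module.finrank ℝ E) → ℝ,
      Real.exp (-t * ‖∑ i, x i • stdOrthonormalBasis ℝ E i‖ ^ 2) =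
        ∏ i, Real.exp (-t * x i ^ 2) := by
    intro x
    rw [← Real.exp_sum, ← Finset.mul_sum, ← real_inner_self_eq_norm_sq,
      (stdOrthonormalBasis ℝ E).orthonormal.inner_sum]
    simp [pow_two]
  simp_rw [e]
  rw [integral_fintype_prod_eq_prod (f := fun _ x => Real.exp (-t * x ^ 2))]
  simp_rw [integral_exp_neg_mul_sq_gaussianReal ht]
  rw [Finset.prod_const, Finset.card_univ, Fintype.card_fin, ← Real.rpow_mul_natCast (by positivity)]
  congr 1
  ring

theorem lintegral_exp_neg_mul_norm_sq_stdGaussian {t : ℝ} (ht : 0 ≤ t) :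
    ∫⁻ x, ENNReal.ofReal (Real.exp (-t * ‖x‖ ^ 2)) ∂(stdGaussian E) =
      ENNReal.ofReal ((1 + 2 * t) ^ (-(Module.finrank ℝ E / 2) : ℝ)) := by
  rw [← integral_exp_neg_mul_norm_sq_stdGaussian ht, ofReal_integral_eq_lintegral_ofReal]
  · apply Integrable.of_integral_ne_zero
    rw [integral_exp_neg_mul_norm_sq_stdGaussian ht]
    positivity
  · exact Filter.Eventually.of_forall fun t => (Real.exp_pos _).le

open Set in
-- The integral of `exp (-t ‖x‖²)` over `t > 0` is infinite at `x = 0`, whereas its expectation is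
-- finite when half the dimension exceeds `1`. This argument is what asks for dimension `3`.
theorem stdGaussian_ae_ne_zero (h : 3 ≤ Module.finrank ℝ E) : ∀ᵐ x ∂(stdGaussian E), x ≠ 0 := by
  have hd : (3 : ℝ) ≤ Module.finrank ℝ E := by exact_mod_cast h
  have key : ∫⁻ x, ∫⁻ t in Ioi (0 : ℝ), ENNReal.ofReal (Real.exp (-t * ‖x‖ ^ 2)) ∂volume
      ∂(stdGaussian E) ≠ ⊤ := by
    rw [lintegral_lintegral_swap (Measurable.aemeasurable (by fun_prop)),
      setLIntegral_congr_fun measurableSet_Ioi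
        (fun t ht => lintegral_exp_neg_mul_norm_sq_stdGaussian (E := E) (le_of_lt ht)),
      lintegral_one_add_two_mul_rpow (by linarith)]
    exact ENNReal.ofReal_ne_top
  filter_upwards [ae_lt_top (Measurable.lintegral_prod_right (by fun_prop)) key] with x hx hx0
  simp [hx0] at hx

open Set in
/-- The inverse first moment of a chi-square variable. -/
theorem lintegral_inv_norm_sq_stdGaussian (h : 3 ≤ Module.finrank ℝ E) :
    ∫⁻ x, ENNReal.ofReal ((‖x‖ ^ 2)⁻¹) ∂(stdGaussian E) =
      ENNReal.ofReal (1 / (Module.finrank ℝ E - 2)) := by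
  have hd : (3 : ℝ) ≤ Module.finrank ℝ E := by exact_mod_cast h
  have e : ∀ᵐ x ∂(stdGaussian E), ENNReal.ofReal ((‖x‖ ^ 2)⁻¹) =
      ∫⁻ t in Ioi (0 : ℝ), ENNReal.ofReal (Real.exp (-t * ‖x‖ ^ 2)) := by
    filter_upwards [stdGaussian_ae_ne_zero h] with x hx
    rw [lintegral_exp_neg_mul_Ioi (by positivity)]
  rw [lintegral_congr_ae e, lintegral_lintegral_swap (Measurable.aemeasurable (by fun_prop)),
      setLIntegral_congr_fun measurableSet_Ioi
        (fun t ht => lintegral_exp_neg_mul_norm_sq_stdGaussian (E := E) (le_of_lt ht)),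
      lintegral_one_add_two_mul_rpow (by linarith)]
  congr 2
  ring

open Set in
/-- The inverse second moment of a chi-square variable. -/
theorem lintegral_inv_norm_sq_sq_stdGaussian (h : 5 ≤ Module.finrank ℝ E) :
    ∫⁻ x, ENNReal.ofReal ((‖x‖ ^ 2)⁻¹ ^ 2) ∂(stdGaussian E) =
      ENNReal.ofReal (1 / ((Module.finrank ℝ E - 2) * (Module.finrank ℝ E - 4))) := by
  have hd : (5 : ℝ) ≤ Module.finrank ℝ E := by exact_mod_cast h
  have e : ∀ᵐ x ∂(stdGaussian E), ENNReal.ofReal ((‖x‖ ^ 2)⁻¹ ^ 2) =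
      ∫⁻ t in Ioi (0 : ℝ), ENNReal.ofReal (t * Real.exp (-t * ‖x‖ ^ 2)) := by
    filter_upwards [stdGaussian_ae_ne_zero (by omega : 3 ≤ Module.finrank ℝ E)] with x hx
    rw [lintegral_mul_exp_neg_mul_Ioi (by positivity)]
  have e' : ∀ t ∈ Ioi (0 : ℝ),
      ∫⁻ x, ENNReal.ofReal (t * Real.exp (-t * ‖x‖ ^ 2)) ∂(stdGaussian E) =
      ENNReal.ofReal (t * (1 + 2 * t) ^ (-(Module.finrank ℝ E / 2) : ℝ)) := by
    intro t ht
    have ht' : (0 : ℝ) ≤ t := le_of_lt ht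
    simp_rw [ENNReal.ofReal_mul ht']
    rw [lintegral_const_mul _ (by fun_prop), lintegral_exp_neg_mul_norm_sq_stdGaussian ht']
  rw [lintegral_congr_ae e, lintegral_lintegral_swap (Measurable.aemeasurable (by fun_prop)),
      setLIntegral_congr_fun measurableSet_Ioi e',
      lintegral_mul_one_add_two_mul_rpow (by linarith)]
  congr 2
  ring

end

/-! ### Projections and resampling of Gaussian vectors -/

section
variable {E : Type*} [NormedAddCommGroup E] [InnerProductSpace ℝ E] [FiniteDimensional ℝ E]
  [MeasurableSpace E] [BorelSpace E]

/-- Projecting and then pairing with a vector of `K` is pairing with that vector in `E`, so the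
characteristic functions agree. -/
theorem stdGaussian_map_orthogonalProjection (K : Submodule ℝ E) :
    (stdGaussian E).map K.orthogonalProjectionOnto = stdGaussian K := by
  apply Measure.ext_of_charFun
  ext t
  rw [charFun_stdGaussian, charFun_apply, integral_map (by fun_prop) (by fun_prop)]
  have e : ∀ x : E, inner ℝ (K.orthogonalProjectionOnto x) t = inner ℝ x (t : E) := by
    intro x
    rw [Submodule.inner_orthogonalProjectionOnto_eq_of_mem_right]
  simp_rw [e]
  rw [← charFun_apply, charFun_stdGaussian]
  simp

theorem lintegral_comp_orthogonalProjection (K : Submodule ℝ E) {f : K → ENNReal}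
    (hf : Measurable f) :
    ∫⁻ x, f (K.orthogonalProjectionOnto x) ∂(stdGaussian E) = ∫⁻ y, f y ∂(stdGaussian K) := by
  rw [← stdGaussian_map_orthogonalProjection K, lintegral_map hf (by fun_prop)]

theorem stdGaussian_ae_notMem (K : Submodule ℝ E) (hK : 3 ≤ Module.finrank ℝ Kᗮ) :
    ∀ᵐ x ∂(stdGaussian E), x ∉ K := by
  have h := stdGaussian_ae_ne_zero hK
  rw [← stdGaussian_map_orthogonalProjection] at h
  filter_upwards [ae_of_ae_map (by fun_prop) h] with x hx hxK
  exact hx (Submodule.orthogonalProjectionOnto_orthogonal_apply_eq_zero hxK)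

theorem stdGaussian_map_neg : (stdGaussian E).map (fun x => -x) = stdGaussian E :=
  stdGaussian_map (LinearIsometryEquiv.neg ℝ)

end

/-- Resampling one coordinate preserves a product of probability measures. -/
theorem measurePreserving_update {ι : Type*} [Fintype ι] [DecidableEq ι] {α : ι → Type*}
    [∀ i, MeasurableSpace (α i)] (μ : ∀ i, Measure (α i)) [∀ i, IsProbabilityMeasure (μ i)]
    (j : ι) :
    MeasurePreserving (fun q : (∀ i, α i) × α j => Function.update q.1 j q.2)
      ((Measure.pi μ).prod (μ j)) (Measure.pi μ) := by
  have hm : Measurable (fun q : (∀ i, α i) × α j => Function.update q.1 j q.2) := by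
    fun_prop
  refine ⟨hm, ?_⟩
  refine (Measure.pi_eq fun s hs => ?_).symm
  rw [Measure.map_apply hm (MeasurableSet.univ_pi hs)]
  -- The preimage of a box is again a product: the old `j`-th coordinate becomes free and the new
  -- one carries its constraint.
  have e : (fun q : (∀ i, α i) × α j => Function.update q.1 j q.2) ⁻¹' Set.univ.pi s =
      (Set.univ.pi (Function.update s j Set.univ)) ×ˢ s j := by
    ext q
    simp only [Set.mem_preimage, Set.mem_univ_pi, Set.mem_prod]
    constructor
    · intro h
      refine ⟨fun i => ?_, by simpa using h j⟩
      rcases eq_or_ne i j with rfl | hij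
      · simp
      · simpa [hij] using h i
    · rintro ⟨h, hj⟩ i
      rcases eq_or_ne i j with rfl | hij
      · simpa using hj
      · simpa [hij] using h i
  rw [e, Measure.prod_prod, Measure.pi_pi, ← Finset.mul_prod_erase _ _ (Finset.mem_univ j),
    ← Finset.mul_prod_erase Finset.univ (fun i => μ i (s i)) (Finset.mem_univ j)]
  rw [Function.update_self, measure_univ, one_mul, mul_comm]
  congr 1
  refine Finset.prod_congr rfl fun i hi => ?_
  rw [Function.update_of_ne (Finset.ne_of_mem_erase hi)]

/-! ### Gram matrices of Gaussian vectors and moments of the inverse Wishart matrix -/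

section
variable {E : Type*} [NormedAddCommGroup E] [InnerProductSpace ℝ E] {ι : Type*}

theorem finrank_orthogonal_span_image [FiniteDimensional ℝ E] {s : Finset ι} {c : ι → E}
    (hs : LinearIndepOn ℝ c (s : Set ι)) :
    s.card + Module.finrank ℝ (Submodule.span ℝ (c '' (s : Set ι)))ᗮ = Module.finrank ℝ E := by
  rw [← Submodule.finrank_add_finrank_orthogonal (Submodule.span ℝ (c '' (s : Set ι)))]
  congr 1
  have := finrank_span_eq_card (R := ℝ) hs
  rw [Set.image_eq_range]
  simpa using this.symm

variable [Fintype ι] [DecidableEq ι]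

open Matrix in
theorem inv_gram_apply_self_nonneg (c : ι → E) (j : ι) :
    0 ≤ ((gram ℝ c)⁻¹ : Matrix ι ι ℝ) j j :=
  (posSemidef_gram ℝ c).inv.diag_nonneg

open Matrix in
-- Positive semidefiniteness tested at `eᵢ ± eⱼ`. It lets diagonal moments control all the entries.
theorem abs_inv_gram_apply_le (c : ι → E) (i j : ι) :
    |((gram ℝ c)⁻¹ : Matrix ι ι ℝ) i j| ≤
      ((gram ℝ c)⁻¹ : Matrix ι ι ℝ) i i + ((gram ℝ c)⁻¹ : Matrix ι ι ℝ) j j := by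
  have hp := (posSemidef_gram ℝ c).inv
  set V := ((gram ℝ c)⁻¹ : Matrix ι ι ℝ)
  have hs : V j i = V i j := by simpa using hp.isHermitian.apply i j
  have hi := hp.diag_nonneg (i := i)
  have hj := hp.diag_nonneg (i := j)
  have h1 := hp.dotProduct_mulVec_nonneg (Pi.single i 1 + Pi.single j 1)
  have h2 := hp.dotProduct_mulVec_nonneg (Pi.single i 1 - Pi.single j 1)
  simp [mulVec_add, mulVec_sub, add_dotProduct, sub_dotProduct] at h1 h2
  rw [abs_le]
  constructor <;> linarith

end

section
variable {E : Type*} [NormedAddCommGroup E] [InnerProductSpace ℝ E] [FiniteDimensional ℝ E]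
variable {ι : Type*} [Fintype ι] [DecidableEq ι]

open Matrix in
/-- The diagonal entry of the inverse Gram matrix is the inverse squared distance to the span of
the other vectors. -/
theorem inv_gram_update_apply_self (c : ι → E) (j : ι) (x : E)
    (hli : LinearIndependent ℝ (Function.update c j x)) :
    ((gram ℝ (Function.update c j x))⁻¹ : Matrix ι ι ℝ) j j =
      (‖(Submodule.span ℝ (c '' {j}ᶜ))ᗮ.orthogonalProjectionOnto x‖ ^ 2)⁻¹ := by
  set v := Function.update c j x with hv
  set K := Submodule.span ℝ (c '' {j}ᶜ) with hK
  have hdet := det_gram_ne_zero_iff_linearIndependent.mpr hli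
  set w : E := Kᗮ.orthogonalProjectionOnto x with hw
  have hwK : w ∈ Kᗮ := Submodule.coe_mem _
  have hxw : x - w ∈ K := by
    have := Submodule.sub_starProjection_mem_orthogonal (K := Kᗮ) x
    rwa [Submodule.orthogonal_orthogonal] at this
  have hvi : ∀ i, i ≠ j → v i ∈ K := fun i hi => by
    rw [hv, Function.update_of_ne hi]
    exact Submodule.subset_span ⟨i, hi, rfl⟩
  have hvj : v j = x := by simp [hv]
  obtain ⟨b, hb⟩ : ∃ b : ι → ℝ, x - w = ∑ i ∈ {j}ᶜ, b i • c i := by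
    rw [hK, show ({j}ᶜ : Set ι) = ((({j}ᶜ : Finset ι)) : Set ι) by simp] at hxw
    obtain ⟨b, hb⟩ := (Submodule.mem_span_image_finset_iff_exists_fun' ℝ).mp hxw
    exact ⟨b, hb.symm⟩
  -- These are the coefficients of `w`, the part of `x` orthogonal to the other vectors. As `w` is
  -- orthogonal to every `v i` with `i ≠ j`, the Gram matrix sends `a` to `‖w‖² eⱼ`; inverting and
  -- reading off `a j = 1` gives the claim.
  let a : ι → ℝ := fun i => if i = j then 1 else -b i
  have ha : ∑ i, a i • v i = w := by
    rw [Fintype.sum_eq_add_sum_compl j]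
    have : ∑ i ∈ {j}ᶜ, a i • v i = -∑ i ∈ {j}ᶜ, b i • c i := by
      rw [← Finset.sum_neg_distrib]
      refine Finset.sum_congr rfl fun i hi => ?_
      have hi' : i ≠ j := by simpa using hi
      simp [a, hi', hv]
    rw [this, ← hb, hvj]
    simp [a]
  have hin : ∀ i, inner ℝ (v i) w = ‖w‖ ^ 2 * (Pi.single j 1 : ι → ℝ) i := by
    intro i
    rcases eq_or_ne i j with rfl | hij
    · rw [hvj, Pi.single_eq_same, mul_one, ← real_inner_self_eq_norm_sq]
      have := (Submodule.mem_orthogonal _ _).mp hwK _ hxw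
      rw [inner_sub_left] at this
      linarith
    · rw [Pi.single_eq_of_ne hij, mul_zero]
      exact (Submodule.mem_orthogonal _ _).mp hwK _ (hvi i hij)
  have hVa : gram ℝ v *ᵥ a = ‖w‖ ^ 2 • (Pi.single j 1 : ι → ℝ) := by
    funext i
    rw [Pi.smul_apply, smul_eq_mul, ← hin, ← ha, inner_sum]
    simp [mulVec, dotProduct, gram_apply, inner_smul_right, mul_comm]
  have hunit : IsUnit (gram ℝ v).det := isUnit_iff_ne_zero.mpr hdet
  have h1 : a = ‖w‖ ^ 2 • ((gram ℝ v)⁻¹ *ᵥ (Pi.single j 1 : ι → ℝ)) := by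
    rw [← mulVec_smul, ← hVa, mulVec_mulVec, nonsing_inv_mul _ hunit, one_mulVec]
  have h2 := congrFun h1 j
  rw [Pi.smul_apply, mulVec_single_one] at h2
  simp only [a, if_pos, col_apply, smul_eq_mul] at h2
  have hnw : ‖Kᗮ.orthogonalProjectionOnto x‖ = ‖w‖ := rfl
  rw [hnw]
  exact eq_inv_of_mul_eq_one_right h2.symm

variable [MeasurableSpace E] [BorelSpace E]

open Matrix in
theorem measurable_inv_gram_apply (i j : ι) :
    Measurable fun c : ι → E => ((gram ℝ c)⁻¹ : Matrix ι ι ℝ) i j := by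
  have hg : Continuous fun c : ι → E => (gram ℝ c : Matrix ι ι ℝ) := by
    refine continuous_matrix fun i j => ?_
    simp only [gram_apply]
    fun_prop
  simp only [inv_def, Ring.inverse_eq_inv', Matrix.smul_apply, smul_eq_mul]
  exact (hg.matrix_det.measurable.inv).mul
    ((continuous_apply_apply i j).comp hg.matrix_adjugate).measurable

/-- Vectors are added one at a time: given the previous ones, a resampled vector almost surely
misses their span, whose codimension is at least `3` by the dimension hypothesis. -/
theorem ae_linearIndepOn (h : Fintype.card ι + 2 ≤ Module.finrank ℝ E) (s : Finset ι) :
    ∀ᵐ c ∂(Measure.pi fun _ : ι => stdGaussian E), LinearIndepOn ℝ c (s : Set ι) := by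
  induction s using Finset.induction_on with
  | empty => simp
  | insert j s hj ih =>
    have hmp := measurePreserving_update (fun _ : ι => stdGaussian E) j
    have hmeas : MeasurableSet {c : ι → E | LinearIndepOn ℝ c ((insert j s : Finset ι) : Set ι)} := by
      have hc : Continuous fun (c : ι → E) (i : ((insert j s : Finset ι) : Set ι)) => c i := by
        fun_prop
      exact (isOpen_setOfPred_linearIndependent.preimage hc).measurableSet
    rw [← hmp.map_eq, ae_map_iff hmp.measurable.aemeasurable hmeas]
    refine (Measure.ae_prod_iff_ae_ae (hmp.measurable hmeas)).mpr ?_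
    filter_upwards [ih] with c hc
    have hcard : s.card + 1 ≤ Fintype.card ι := by
      rw [← Finset.card_insert_of_notMem hj]; exact Finset.card_le_univ _
    have hfin := finrank_orthogonal_span_image hc
    filter_upwards [stdGaussian_ae_notMem (Submodule.span ℝ (c '' (s : Set ι))) (by omega)] with x hx
    have heq : Set.EqOn (Function.update c j x) c (s : Set ι) := fun i hi => by
      rw [Function.update_of_ne]
      rintro rfl
      exact hj hi
    rw [Finset.coe_insert, linearIndepOn_insert (by simpa using hj), heq.image_eq,
      Function.update_self]
    exact ⟨hc.congr heq.symm, hx⟩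

theorem ae_linearIndependent (h : Fintype.card ι + 2 ≤ Module.finrank ℝ E) :
    ∀ᵐ c ∂(Measure.pi fun _ : ι => stdGaussian E), LinearIndependent ℝ c := by
  filter_upwards [ae_linearIndepOn (E := E) h Finset.univ] with c hc
  simpa [linearIndepOn_univ_iff] using hc

open Matrix in
-- Resample the `j`-th vector with the others fixed. Its component orthogonal to their span is
-- standard Gaussian on a subspace of dimension `finrank E - card ι + 1`, whatever the others are. A
-- general `F` serves the first and the second moment at once.
theorem lintegral_inv_gram_apply_self (h : Fintype.card ι + 2 ≤ Module.finrank ℝ E) (j : ι)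
    {F : ℝ → ENNReal} (hF : Measurable F) {I : ENNReal}
    (hI : ∀ K : Submodule ℝ E, Module.finrank ℝ K + Fintype.card ι = Module.finrank ℝ E + 1 →
      ∫⁻ y, F ((‖y‖ ^ 2)⁻¹) ∂(stdGaussian K) = I) :
    ∫⁻ c, F (((gram ℝ c)⁻¹ : Matrix ι ι ℝ) j j) ∂(Measure.pi fun _ : ι => stdGaussian E) = I := by
  have hmp := measurePreserving_update (fun _ : ι => stdGaussian E) j
  have hm : Measurable fun c : ι → E => F (((gram ℝ c)⁻¹ : Matrix ι ι ℝ) j j) :=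
    hF.comp (measurable_inv_gram_apply j j)
  rw [← hmp.lintegral_comp hm]
  refine (lintegral_prod _ (hm.comp hmp.measurable).aemeasurable).trans ?_
  have hli := ae_linearIndependent (E := E) h
  have hli' : ∀ᵐ c ∂(Measure.pi fun _ : ι => stdGaussian E), ∀ᵐ x ∂(stdGaussian E),
      LinearIndependent ℝ (Function.update c j x) := by
    refine Measure.ae_ae_of_ae_prod (p := fun q : (ι → E) × E =>
      LinearIndependent ℝ (Function.update q.1 j q.2)) ?_
    rw [← hmp.map_eq] at hli
    exact ae_of_ae_map hmp.measurable.aemeasurable hli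
  have : ∀ᵐ c ∂(Measure.pi fun _ : ι => stdGaussian E),
      ∫⁻ x, F (((gram ℝ (Function.update c j x))⁻¹ : Matrix ι ι ℝ) j j) ∂(stdGaussian E) = I := by
    filter_upwards [hli, hli'] with c hc hc'
    have hcj : LinearIndepOn ℝ c (({j}ᶜ : Finset ι) : Set ι) := hc.linearIndepOn _
    have hfin := finrank_orthogonal_span_image hcj
    rw [Finset.card_compl, Finset.card_singleton] at hfin
    have hpos : 0 < Fintype.card ι := Fintype.card_pos_iff.mpr ⟨j⟩
    have hset : ((({j}ᶜ : Finset ι)) : Set ι) = {j}ᶜ := by simp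
    rw [hset] at hfin
    rw [← hI (Submodule.span ℝ (c '' {j}ᶜ))ᗮ (by omega),
      ← lintegral_comp_orthogonalProjection _ (f := fun y => F ((‖y‖ ^ 2)⁻¹))
        (hF.comp (by fun_prop))]
    refine lintegral_congr_ae ?_
    filter_upwards [hc'] with x hx
    rw [inv_gram_update_apply_self c j x hx]
  refine (lintegral_congr_ae this).trans ?_
  simp

open Matrix in
-- The hypothesis leaves at least `5` degrees of freedom, as the second inverse moment of a
-- chi-square variable requires.
theorem memLp_inv_gram_apply (h : Fintype.card ι + 4 ≤ Module.finrank ℝ E) (i j : ι) :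
    MemLp (fun c : ι → E => ((gram ℝ c)⁻¹ : Matrix ι ι ℝ) i j) 2
      (Measure.pi fun _ : ι => stdGaussian E) := by
  have hd : ∀ j : ι, MemLp (fun c : ι → E => ((gram ℝ c)⁻¹ : Matrix ι ι ℝ) j j) 2
      (Measure.pi fun _ : ι => stdGaussian E) := by
    intro j
    rw [memLp_two_iff_integrable_sq (measurable_inv_gram_apply j j).aestronglyMeasurable]
    refine ⟨((measurable_inv_gram_apply j j).pow_const 2).aestronglyMeasurable, ?_⟩
    rw [hasFiniteIntegral_iff_ofReal (Filter.Eventually.of_forall fun c => sq_nonneg _)]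
    rw [lintegral_inv_gram_apply_self (by omega) j (F := fun x => ENNReal.ofReal (x ^ 2))
      (by fun_prop) (I := ENNReal.ofReal (1 /
        (((Module.finrank ℝ E + 1 - Fintype.card ι : ℕ) - 2) *
          ((Module.finrank ℝ E + 1 - Fintype.card ι : ℕ) - 4))))]
    · exact ENNReal.ofReal_lt_top
    · intro K hK
      rw [lintegral_inv_norm_sq_sq_stdGaussian (by omega), ← hK, Nat.add_sub_cancel]
  refine ((hd i).add (hd j)).mono (measurable_inv_gram_apply i j).aestronglyMeasurable
    (Filter.Eventually.of_forall fun c => ?_)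
  rw [Real.norm_eq_abs, Real.norm_eq_abs]
  exact (abs_inv_gram_apply_le c i j).trans (le_abs_self _)

open Matrix in
/-- The mean of the diagonal of an inverse Wishart matrix. -/
theorem integral_inv_gram_apply_self (h : Fintype.card ι + 2 ≤ Module.finrank ℝ E) (j : ι) :
    ∫ c, ((gram ℝ c)⁻¹ : Matrix ι ι ℝ) j j ∂(Measure.pi fun _ : ι => stdGaussian E) =
      1 / ((Module.finrank ℝ E : ℝ) - Fintype.card ι - 1) := by
  rw [integral_eq_lintegral_of_nonneg_ae (Filter.Eventually.of_forall fun c =>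
    inv_gram_apply_self_nonneg c j) (measurable_inv_gram_apply j j).aestronglyMeasurable]
  have hr : (Fintype.card ι : ℝ) + 2 ≤ Module.finrank ℝ E := by exact_mod_cast h
  rw [lintegral_inv_gram_apply_self h j (F := ENNReal.ofReal) ENNReal.measurable_ofReal
    (I := ENNReal.ofReal (1 / ((Module.finrank ℝ E : ℝ) - Fintype.card ι - 1))),
    ENNReal.toReal_ofReal (one_div_nonneg.mpr (by linarith))]
  intro K hK
  have hK' : (Module.finrank ℝ K : ℝ) + Fintype.card ι = Module.finrank ℝ E + 1 := by
    exact_mod_cast hK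
  rw [lintegral_inv_norm_sq_stdGaussian (by omega)]
  congr 2
  linarith

open Matrix in
/-- The second moment of the diagonal of an inverse Wishart matrix. -/
theorem integral_inv_gram_apply_self_sq (h : Fintype.card ι + 4 ≤ Module.finrank ℝ E) (j : ι) :
    ∫ c, ((gram ℝ c)⁻¹ : Matrix ι ι ℝ) j j ^ 2 ∂(Measure.pi fun _ : ι => stdGaussian E) =
      1 / (((Module.finrank ℝ E : ℝ) - Fintype.card ι - 1) *
        ((Module.finrank ℝ E : ℝ) - Fintype.card ι - 3)) := by
  rw [integral_eq_lintegral_of_nonneg_ae (Filter.Eventually.of_forall fun c =>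
    sq_nonneg _) ((measurable_inv_gram_apply j j).pow_const 2).aestronglyMeasurable]
  have hr : (Fintype.card ι : ℝ) + 4 ≤ Module.finrank ℝ E := by exact_mod_cast h
  rw [lintegral_inv_gram_apply_self (by omega) j (F := fun x => ENNReal.ofReal (x ^ 2))
    (by fun_prop) (I := ENNReal.ofReal (1 / (((Module.finrank ℝ E : ℝ) - Fintype.card ι - 1) *
        ((Module.finrank ℝ E : ℝ) - Fintype.card ι - 3)))),
    ENNReal.toReal_ofReal (one_div_nonneg.mpr (mul_nonneg (by linarith) (by linarith)))]
  intro K hK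
  have hK' : (Module.finrank ℝ K : ℝ) + Fintype.card ι = Module.finrank ℝ E + 1 := by
    exact_mod_cast hK
  rw [lintegral_inv_norm_sq_sq_stdGaussian (by omega)]
  congr 3 <;> linarith

end

/-! ### Sign symmetry and the moments of `G⁻¹ (ν + τ y)` -/

/-- The sign that is `-1` at `j` and `1` elsewhere. -/
noncomputable def flipSign {ι : Type*} [DecidableEq ι] (j i : ι) : ℝ := if i = j then -1 else 1

theorem flipSign_mul_self {ι : Type*} [DecidableEq ι] (j i : ι) : flipSign j i * flipSign j i = 1 := by
  unfold flipSign; split_ifs <;> norm_num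

section
variable {E : Type*} [NormedAddCommGroup E] [InnerProductSpace ℝ E] [FiniteDimensional ℝ E]
  [MeasurableSpace E] [BorelSpace E] {ι : Type*} [Fintype ι]

variable (E ι) in
/-- Independent standard normal numbers and vectors. -/
noncomputable def stdPairLaw : Measure ((ι → ℝ) × (ι → E)) :=
  (Measure.pi fun _ => gaussianReal 0 1).prod (Measure.pi fun _ => stdGaussian E)

instance : IsProbabilityMeasure (stdPairLaw E ι) := by unfold stdPairLaw; infer_instance

theorem measurePreserving_snd_stdPairLaw :
    MeasurePreserving Prod.snd (stdPairLaw E ι) (Measure.pi fun _ => stdGaussian E) :=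
  measurePreserving_snd

theorem measurePreserving_fst_stdPairLaw :
    MeasurePreserving Prod.fst (stdPairLaw E ι) (Measure.pi fun _ => gaussianReal 0 1) :=
  measurePreserving_fst

end

section
variable {E : Type*} [NormedAddCommGroup E] [InnerProductSpace ℝ E]
variable {ι : Type*} [Fintype ι] [DecidableEq ι]

/-- The coordinates of `G⁻¹ (ν + τ y)` for the Gram matrix `G` of the vectors `c`. -/
noncomputable def gramSolve (ν : ι → ℝ) (τ : ℝ) (ω : (ι → ℝ) × (ι → E)) : ι → ℝ :=
  (Matrix.gram ℝ ω.2)⁻¹ *ᵥ fun i => ν i + τ * ω.1 i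

open Matrix in
theorem gramSolve_apply (ν : ι → ℝ) (τ : ℝ) (ω : (ι → ℝ) × (ι → E)) (j : ι) :
    gramSolve ν τ ω j =
      ∑ i, ((gram ℝ ω.2)⁻¹ : Matrix ι ι ℝ) j i * (ν i + τ * ω.1 i) := rfl

open Matrix in
theorem inv_gram_smul_apply {ε : ι → ℝ} (hε : ∀ i, ε i * ε i = 1) (c : ι → E) (i j : ι) :
    ((gram ℝ fun i => ε i • c i)⁻¹ : Matrix ι ι ℝ) i j =
      ε i * ε j * ((gram ℝ c)⁻¹ : Matrix ι ι ℝ) i j := by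
  have hD : (diagonal ε)⁻¹ = diagonal ε := by
    apply inv_eq_left_inv
    rw [diagonal_mul_diagonal]
    simp [hε]
  have e : gram ℝ (fun i => ε i • c i) = diagonal ε * gram ℝ c * diagonal ε := by
    ext i j
    rw [mul_diagonal, diagonal_mul, gram_apply, gram_apply, real_inner_smul_left,
      real_inner_smul_right]
    ring
  rw [e, Matrix.mul_inv_rev, Matrix.mul_inv_rev, hD, ← Matrix.mul_assoc, mul_diagonal, diagonal_mul]
  ring

/-- Changing the sign of the `j`-th coordinates. -/
noncomputable def flipAt (j : ι) (ω : (ι → ℝ) × (ι → E)) : (ι → ℝ) × (ι → E) :=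
  (fun i => flipSign j i * ω.1 i, fun i => flipSign j i • ω.2 i)

open Matrix in
-- The flip negates the entries `(j, i)` of the inverse for `i ≠ j`, so those terms cancel. It keeps
-- the entry `(j, j)` but negates `yⱼ`, which leaves only the `νⱼ` term.
theorem gramSolve_add_gramSolve_flipAt (ν : ι → ℝ) (τ : ℝ) (ω : (ι → ℝ) × (ι → E)) (j : ι) :
    gramSolve ν τ ω j + gramSolve ν τ (flipAt j ω) j =
      2 * (ν j * ((gram ℝ ω.2)⁻¹ : Matrix ι ι ℝ) j j) := by
  rw [gramSolve_apply, gramSolve_apply, ← Finset.sum_add_distrib,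
    Finset.sum_eq_single j]
  · simp only [flipAt, inv_gram_smul_apply (flipSign_mul_self j)]
    simp only [flipSign, if_pos]
    ring
  · intro i _ hi
    simp only [flipAt, inv_gram_smul_apply (flipSign_mul_self j)]
    simp only [flipSign, if_pos, if_neg hi]
    ring
  · simp

variable [FiniteDimensional ℝ E] [MeasurableSpace E] [BorelSpace E]

theorem measurePreserving_flipAt (j : ι) :
    MeasurePreserving (flipAt j) (stdPairLaw E ι) (stdPairLaw E ι) := by
  refine MeasurePreserving.prod (f := fun (y : ι → ℝ) i => flipSign j i * y i)
    (g := fun (c : ι → E) i => flipSign j i • c i) ?_ ?_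
  · refine measurePreserving_pi (fun _ => gaussianReal 0 1) (fun _ => gaussianReal 0 1)
      (f := fun i y => flipSign j i * y) fun i => ⟨by fun_prop, ?_⟩
    unfold flipSign
    split_ifs
    · simp [gaussianReal_map_neg]
    · simp
  · refine measurePreserving_pi (fun _ => stdGaussian E) (fun _ => stdGaussian E)
      (f := fun i y => flipSign j i • y) fun i => ?_
    refine ⟨by fun_prop, ?_⟩
    unfold flipSign
    split_ifs
    · simp [stdGaussian_map_neg]
    · simp

theorem measurable_gramSolve (ν : ι → ℝ) (τ : ℝ) :
    Measurable (gramSolve ν τ : (ι → ℝ) × (ι → E) → ι → ℝ) := by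
  refine measurable_pi_iff.mpr fun j => ?_
  simp only [gramSolve_apply]
  refine Finset.measurable_sum _ fun i _ => ?_
  exact ((measurable_inv_gram_apply j i).comp measurable_snd).mul (by fun_prop)

theorem memLp_gramSolve (h : Fintype.card ι + 4 ≤ Module.finrank ℝ E) (ν : ι → ℝ) (τ : ℝ)
    (j : ι) : MemLp (fun ω => gramSolve ν τ ω j) 2 (stdPairLaw E ι) := by
  simp only [gramSolve_apply]
  refine memLp_finsetSum _ fun i _ => ?_
  have hy : MemLp (fun y : ι → ℝ => ν i + τ * y i) 2 (Measure.pi fun _ => gaussianReal 0 1) := by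
    have hi : MemLp (fun y : ι → ℝ => y i) 2 (Measure.pi fun _ => gaussianReal 0 1) :=
      (memLp_id_gaussianReal' 2 (by simp)).comp_measurePreserving
        (measurePreserving_eval (fun _ : ι => gaussianReal 0 1) i)
    exact (memLp_const (ν i)).add (hi.const_mul τ)
  rw [memLp_two_iff_integrable_sq]
  · simp only [mul_pow]
    have := (hy.integrable_sq).mul_prod (memLp_inv_gram_apply (E := E) h j i).integrable_sq
    refine this.congr (Filter.Eventually.of_forall fun ω => ?_)
    exact mul_comm _ _
  · exact (((measurable_inv_gram_apply j i).comp measurable_snd).mul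
      (by fun_prop)).aestronglyMeasurable

open Matrix in
-- The flip preserves the law, so the mean equals that of the symmetrised variable, `νⱼ` times a
-- diagonal entry of the inverse Wishart matrix. No off-diagonal moment is needed.
theorem integral_gramSolve (h : Fintype.card ι + 4 ≤ Module.finrank ℝ E) (ν : ι → ℝ) (τ : ℝ)
    (j : ι) : ∫ ω, gramSolve ν τ ω j ∂(stdPairLaw E ι) =
      ν j * (1 / ((Module.finrank ℝ E : ℝ) - Fintype.card ι - 1)) := by
  have hT := measurePreserving_flipAt (E := E) j
  have hint := (memLp_gramSolve (E := E) h ν τ j).integrable (by norm_num)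
  have hm := measurable_pi_iff.mp (measurable_gramSolve (E := E) ν τ) j
  have h1 : ∫ ω, gramSolve ν τ (flipAt j ω) j ∂(stdPairLaw E ι) =
      ∫ ω, gramSolve ν τ ω j ∂(stdPairLaw E ι) := by
    conv_rhs => rw [← hT.map_eq]
    rw [integral_map hT.measurable.aemeasurable hm.aestronglyMeasurable]
  have h2 := integral_add hint (hT.integrable_comp_of_integrable hint)
  simp only [Function.comp_apply, gramSolve_add_gramSolve_flipAt] at h2
  rw [h1, integral_const_mul, integral_const_mul] at h2
  have h3 := integral_inv_gram_apply_self (ι := ι) (E := E) (by omega) j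
  rw [← (measurePreserving_snd_stdPairLaw (ι := ι) (E := E)).map_eq,
    integral_map measurable_snd.aemeasurable
      (measurable_inv_gram_apply j j).aestronglyMeasurable] at h3
  rw [h3] at h2
  linarith

open Matrix in
-- Symmetrising under the flip can only decrease the second moment, since `u² + v² ≥ (u + v)² / 2`.
theorem le_integral_gramSolve_sq (h : Fintype.card ι + 4 ≤ Module.finrank ℝ E) (ν : ι → ℝ)
    (τ : ℝ) (j : ι) :
    ν j ^ 2 * (1 / (((Module.finrank ℝ E : ℝ) - Fintype.card ι - 1) *
        ((Module.finrank ℝ E : ℝ) - Fintype.card ι - 3))) ≤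
      ∫ ω, gramSolve ν τ ω j ^ 2 ∂(stdPairLaw E ι) := by
  have hT := measurePreserving_flipAt (E := E) j
  have hint := (memLp_gramSolve (E := E) h ν τ j).integrable_sq
  have hm := (measurable_pi_iff.mp (measurable_gramSolve (E := E) ν τ) j).pow_const 2
  have hintT : Integrable (fun ω => gramSolve ν τ (flipAt j ω) j ^ 2) (stdPairLaw E ι) :=
    hT.integrable_comp_of_integrable hint
  have h1 : ∫ ω, gramSolve ν τ (flipAt j ω) j ^ 2 ∂(stdPairLaw E ι) =
      ∫ ω, gramSolve ν τ ω j ^ 2 ∂(stdPairLaw E ι) := by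
    conv_rhs => rw [← hT.map_eq]
    rw [integral_map hT.measurable.aemeasurable hm.aestronglyMeasurable]
  have h3 := integral_inv_gram_apply_self_sq (ι := ι) (E := E) h j
  rw [← (measurePreserving_snd_stdPairLaw (ι := ι) (E := E)).map_eq,
    integral_map measurable_snd.aemeasurable
      ((measurable_inv_gram_apply j j).pow_const 2).aestronglyMeasurable] at h3
  have hg : Integrable (fun ω : (ι → ℝ) × (ι → E) => ((gram ℝ ω.2)⁻¹ : Matrix ι ι ℝ) j j ^ 2)
      (stdPairLaw E ι) :=
    measurePreserving_snd_stdPairLaw.integrable_comp_of_integrable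
      (memLp_inv_gram_apply (E := E) h j j).integrable_sq
  have h2 : ∫ ω, 2 * (ν j ^ 2 * ((gram ℝ ω.2)⁻¹ : Matrix ι ι ℝ) j j ^ 2) ∂(stdPairLaw E ι) ≤
      ∫ ω, (gramSolve ν τ ω j ^ 2 + gramSolve ν τ (flipAt j ω) j ^ 2) ∂(stdPairLaw E ι) := by
    refine integral_mono ((hg.const_mul _).const_mul _) (hint.add hintT) fun ω => ?_
    have := gramSolve_add_gramSolve_flipAt ν τ ω j
    have hsq := sq_nonneg (gramSolve ν τ ω j - gramSolve ν τ (flipAt j ω) j)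
    have hsq' : (gramSolve ν τ ω j + gramSolve ν τ (flipAt j ω) j) ^ 2 =
      (2 * (ν j * ((gram ℝ ω.2)⁻¹ : Matrix ι ι ℝ) j j)) ^ 2 := by rw [this]
    show 2 * (ν j ^ 2 * ((gram ℝ ω.2)⁻¹ : Matrix ι ι ℝ) j j ^ 2) ≤
      gramSolve ν τ ω j ^ 2 + gramSolve ν τ (flipAt j ω) j ^ 2
    nlinarith
  rw [integral_add hint hintT, h1, integral_const_mul, integral_const_mul, h3] at h2
  linarith

theorem ae_linearIndependent_stdPairLaw (h : Fintype.card ι + 2 ≤ Module.finrank ℝ E) :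
    ∀ᵐ ω ∂(stdPairLaw E ι), LinearIndependent ℝ ω.2 :=
  measurePreserving_snd_stdPairLaw.quasiMeasurePreserving.ae (ae_linearIndependent h)

open Matrix in
-- Otherwise the solution vanishes almost surely; multiplying by the invertible Gram matrix gives `ν
-- + τ y = 0`, impossible because the law of `yᵢ` has no atom.
theorem integral_sum_gramSolve_sq_pos [Nonempty ι]
    (h : Fintype.card ι + 4 ≤ Module.finrank ℝ E) (ν : ι → ℝ) {τ : ℝ} (hτ : τ ≠ 0)
    {w : ι → ℝ} (hw : ∀ i, 0 < w i) :
    0 < ∑ j, w j * ∫ ω, gramSolve ν τ ω j ^ 2 ∂(stdPairLaw E ι) := by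
  have hnn : ∀ j ∈ Finset.univ, 0 ≤ w j * ∫ ω, gramSolve ν τ ω j ^ 2 ∂(stdPairLaw E ι) :=
    fun j _ => mul_nonneg (hw j).le (integral_nonneg fun ω => sq_nonneg _)
  refine lt_of_le_of_ne (Finset.sum_nonneg hnn) fun h0 => ?_
  have hz := (Finset.sum_eq_zero_iff_of_nonneg hnn).mp h0.symm
  have hz' : ∀ j, ∀ᵐ ω ∂(stdPairLaw E ι), gramSolve ν τ ω j = 0 := by
    intro j
    have h1 := (mul_eq_zero.mp (hz j (Finset.mem_univ j))).resolve_left (hw j).ne'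
    rw [integral_eq_zero_iff_of_nonneg (fun ω => sq_nonneg _)
      (memLp_gramSolve (E := E) h ν τ j).integrable_sq] at h1
    filter_upwards [h1] with ω hω
    exact pow_eq_zero_iff (two_ne_zero) |>.mp hω
  obtain ⟨i⟩ := ‹Nonempty ι›
  have hne : ∀ᵐ ω ∂(stdPairLaw E ι), ω.1 i ≠ -ν i / τ := by
    have h1 : ∀ᵐ y ∂(Measure.pi fun _ : ι => gaussianReal 0 1), y i ≠ -ν i / τ := by
      have := nullSingletonClass_gaussianReal (μ := 0) (v := 1) one_ne_zero
      have h2 : ∀ᵐ y ∂(gaussianReal 0 1), y ≠ -ν i / τ := by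
        rw [ae_iff]; simp
      exact (measurePreserving_eval (fun _ : ι => gaussianReal 0 1) i).quasiMeasurePreserving.ae h2
    exact measurePreserving_fst_stdPairLaw.quasiMeasurePreserving.ae h1
  obtain ⟨ω, hω, hω', hω''⟩ := ((ae_all_iff.mpr hz').and
    (hne.and (ae_linearIndependent_stdPairLaw (E := E) (ι := ι) (by omega)))).exists
  have hdet : IsUnit (gram ℝ ω.2).det :=
    isUnit_iff_ne_zero.mpr (det_gram_ne_zero_iff_linearIndependent.mpr hω'')
  have h1 : gramSolve ν τ ω = 0 := funext hω
  have h2 : (gram ℝ ω.2) *ᵥ gramSolve ν τ ω = fun i => ν i + τ * ω.1 i := by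
    rw [gramSolve, mulVec_mulVec, mul_nonsing_inv _ hdet, one_mulVec]
  rw [h1, mulVec_zero] at h2
  have h3 := congrFun h2 i
  apply hω'
  rw [Pi.zero_apply] at h3
  field_simp
  linarith

end

/-! ### The law of the sample in Gaussian coordinates -/

/-- Transposing an array of independent, identically distributed entries preserves its law, as is
seen on boxes of boxes. It turns `n` noise vectors in `ℝʳ` into `r` vectors in `ℝⁿ`. -/
theorem pi_map_swap {α β X : Type*} [Fintype α] [Fintype β] [MeasurableSpace X]
    (ν : Measure X) [IsProbabilityMeasure ν] :
    (Measure.pi fun _ : α => Measure.pi fun _ : β => ν).map (fun w j i => w i j) =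
      Measure.pi fun _ : β => Measure.pi fun _ : α => ν := by
  symm
  refine Measure.pi_eq_generateFrom (fun _ => generateFrom_pi) (fun _ => isPiSystem_pi)
    (fun _ => Measure.FiniteSpanningSetsIn.pi fun _ => ν.toFiniteSpanningSetsIn) ?_
  intro s hs
  choose t ht hst using hs
  have ht' : ∀ j i, MeasurableSet (t j i) := fun j i => ht j i (Set.mem_univ i)
  have hm : Measurable fun (w : α → β → X) j i => w i j := by fun_prop
  have hms : ∀ j, MeasurableSet (s j) := fun j => by
    rw [← hst j]; exact MeasurableSet.univ_pi (ht' j)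
  rw [Measure.map_apply hm (MeasurableSet.univ_pi hms)]
  have e : (fun (w : α → β → X) j i => w i j) ⁻¹' Set.univ.pi s =
      Set.univ.pi fun i => Set.univ.pi fun j => t j i := by
    ext w
    simp only [← hst, Set.mem_preimage, Set.mem_univ_pi]
    exact forall_comm
  rw [e, Measure.pi_pi]
  simp_rw [← hst, Measure.pi_pi]
  exact Finset.prod_comm

section
variable {E : Type*} [NormedAddCommGroup E] [InnerProductSpace ℝ E] [FiniteDimensional ℝ E]
  [MeasurableSpace E] [BorelSpace E]

/-- A standard Gaussian vector splits into independent components along and across a line. -/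
theorem stdGaussian_eq_map_prod {u : E} (hu : ‖u‖ = 1) :
    stdGaussian E = ((gaussianReal 0 1).prod (stdGaussian (ℝ ∙ u)ᗮ)).map
      (fun q => q.1 • u + (q.2 : E)) := by
  apply Measure.ext_of_charFun
  ext t
  rw [charFun_stdGaussian, charFun_apply, integral_map (Measurable.aemeasurable (by fun_prop))
    (Measurable.aestronglyMeasurable (by fun_prop))]
  have e : ∀ q : ℝ × (ℝ ∙ u)ᗮ, Complex.exp (inner ℝ (q.1 • u + (q.2 : E)) t * Complex.I) =
      Complex.exp (inner ℝ q.1 (inner ℝ u t) * Complex.I) *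
        Complex.exp (inner ℝ q.2 ((ℝ ∙ u)ᗮ.orthogonalProjectionOnto t) * Complex.I) := by
    intro q
    rw [← Complex.exp_add, inner_add_left, real_inner_smul_left,
      Submodule.inner_orthogonalProjectionOnto_eq_of_mem_left]
    push_cast
    rw [add_mul]
    congr 3
    simp [mul_comm]
  simp_rw [e]
  rw [integral_prod_mul (fun y : ℝ => Complex.exp (inner ℝ y (inner ℝ u t) * Complex.I))
    (fun c : (ℝ ∙ u)ᗮ =>
      Complex.exp (inner ℝ c ((ℝ ∙ u)ᗮ.orthogonalProjectionOnto t) * Complex.I)),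
    ← charFun_apply, ← charFun_apply, charFun_gaussianReal, charFun_stdGaussian,
    ← Complex.exp_add]
  congr 1
  have h1 := Submodule.norm_sq_eq_add_norm_sq_projection t (ℝ ∙ u)
  have h2 : ‖(ℝ ∙ u).orthogonalProjectionOnto t‖ ^ 2 = (inner ℝ u t) ^ 2 := by
    rw [← Submodule.norm_coe, ← Submodule.starProjection_apply,
      Submodule.starProjection_unit_singleton ℝ hu, norm_smul, hu, mul_one, Real.norm_eq_abs,
      sq_abs]
  rw [h2] at h1
  have h3 : ((‖t‖ ^ 2 : ℝ) : ℂ) =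
      (((inner ℝ u t) ^ 2 + ‖(ℝ ∙ u)ᗮ.orthogonalProjectionOnto t‖ ^ 2 : ℝ) : ℂ) := by rw [h1]
  push_cast at h3
  rw [h3]
  simp
  ring

theorem pi_stdGaussian_eq_map_stdPairLaw {ι : Type*} [Fintype ι] {u : E} (hu : ‖u‖ = 1) :
    (Measure.pi fun _ : ι => stdGaussian E) =
      (stdPairLaw (ℝ ∙ u)ᗮ ι).map (fun ω j => ω.1 j • u + (ω.2 j : E)) := by
  have h := measurePreserving_arrowProdEquivProdArrow ℝ (ℝ ∙ u)ᗮ ι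
    (fun _ => gaussianReal 0 1) (fun _ => stdGaussian (ℝ ∙ u)ᗮ)
  rw [stdPairLaw, ← h.map_eq, Measure.map_map (by fun_prop) h.measurable]
  conv_lhs => rw [stdGaussian_eq_map_prod hu]
  have : IsProbabilityMeasure (((gaussianReal 0 1).prod (stdGaussian (ℝ ∙ u)ᗮ)).map
      (fun q => q.1 • u + (q.2 : E))) := by
    rw [← stdGaussian_eq_map_prod hu]; infer_instance
  rw [← Measure.pi_map_pi (fun _ => Measurable.aemeasurable (by fun_prop))]
  rfl

end

theorem pi_stdGaussian_eq_map_pi_pi (γ δ : Type*) [Fintype γ] [Fintype δ] :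
    (Measure.pi fun _ : γ => stdGaussian (EuclideanSpace ℝ δ)) =
      (Measure.pi fun _ : γ => Measure.pi fun _ : δ => gaussianReal 0 1).map
        (fun w i => WithLp.toLp 2 (w i)) := by
  refine (measurePreserving_pi (fun _ => Measure.pi fun _ : δ => gaussianReal 0 1)
    (fun _ => stdGaussian (EuclideanSpace ℝ δ)) (f := fun _ => WithLp.toLp 2)
    fun _ => ⟨by fun_prop, map_pi_eq_stdGaussian⟩).map_eq.symm

theorem pi_stdGaussian_map_swap {α β : Type*} [Fintype α] [Fintype β] :
    (Measure.pi fun _ : β => stdGaussian (EuclideanSpace ℝ α)).map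
        (fun w i => WithLp.toLp 2 fun j => w j i) =
      Measure.pi fun _ : α => stdGaussian (EuclideanSpace ℝ β) := by
  rw [pi_stdGaussian_eq_map_pi_pi, pi_stdGaussian_eq_map_pi_pi, ← pi_map_swap,
    Measure.map_map (by fun_prop) (by fun_prop), Measure.map_map (by fun_prop) (by fun_prop)]
  rfl

open Matrix in
-- Compare characteristic functions, using `‖Aᵗ t‖² = tᵗ A Aᵗ t`. Any factor `A` of the covariance
-- may be used, in particular one with only `r` columns.
theorem multivariateGaussian_eq_map {κ ι : Type*} [Fintype κ] [DecidableEq κ] [Fintype ι]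
    (μ : EuclideanSpace ℝ κ) (A : Matrix κ ι ℝ) :
    multivariateGaussian μ (A * Aᵀ) = (stdGaussian (EuclideanSpace ℝ ι)).map
      (fun z => WithLp.toLp 2 fun k => μ k + (A *ᵥ z.ofLp) k) := by
  have hA : (A * Aᵀ).PosSemidef := by
    simpa using posSemidef_self_mul_conjTranspose A
  have hm : Measurable fun z : EuclideanSpace ℝ ι =>
      (WithLp.toLp 2 fun k => μ k + (A *ᵥ z.ofLp) k : EuclideanSpace ℝ κ) := by
    simp only [mulVec, dotProduct]
    fun_prop
  have hmap : IsProbabilityMeasure ((stdGaussian (EuclideanSpace ℝ ι)).map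
      (fun z => (WithLp.toLp 2 fun k => μ k + (A *ᵥ z.ofLp) k : EuclideanSpace ℝ κ))) :=
    Measure.isProbabilityMeasure_map hm.aemeasurable
  apply Measure.ext_of_charFun
  ext t
  rw [charFun_multivariateGaussian hA, charFun_apply, integral_map hm.aemeasurable
    (Measurable.aestronglyMeasurable (by fun_prop))]
  have e : ∀ z : EuclideanSpace ℝ ι,
      inner ℝ (WithLp.toLp 2 fun k => μ k + (A *ᵥ z.ofLp) k : EuclideanSpace ℝ κ) t =
        inner ℝ t μ + inner ℝ z (WithLp.toLp 2 (Aᵀ *ᵥ t.ofLp)) := by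
    intro z
    have h1 : (WithLp.toLp 2 fun k => μ k + (A *ᵥ z.ofLp) k : EuclideanSpace ℝ κ) =
      μ + WithLp.toLp 2 (A *ᵥ z.ofLp) := rfl
    rw [h1, inner_add_left, real_inner_comm]
    congr 1
    simp only [EuclideanSpace.inner_eq_star_dotProduct, star_trivial]
    rw [mulVec_transpose, dotProduct_mulVec]
  simp_rw [e, Complex.ofReal_add, add_mul, Complex.exp_add]
  rw [integral_const_mul, ← charFun_apply, charFun_stdGaussian, ← Complex.exp_add]
  congr 1
  have h2 : ‖(WithLp.toLp 2 (Aᵀ *ᵥ t.ofLp) : EuclideanSpace ℝ ι)‖ ^ 2 =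
      t.ofLp ⬝ᵥ (A * Aᵀ) *ᵥ t.ofLp := by
    rw [← real_inner_self_eq_norm_sq, EuclideanSpace.inner_eq_star_dotProduct, star_trivial]
    show Aᵀ *ᵥ t.ofLp ⬝ᵥ Aᵀ *ᵥ t.ofLp = _
    rw [← mulVec_mulVec, dotProduct_mulVec t.ofLp, mulVec_transpose]
  rw [← Complex.ofReal_pow, h2]
  ring

/-- The unit vector along the diagonal of `ℝⁿ`. -/
noncomputable def unitOnes (n : ℕ) : EuclideanSpace ℝ (Fin n) :=
  WithLp.toLp 2 fun _ => (√n)⁻¹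

theorem norm_unitOnes {n : ℕ} (hn : 0 < n) : ‖unitOnes n‖ = 1 := by
  have hn' : (0 : ℝ) < n := by exact_mod_cast hn
  rw [← sq_eq_sq₀ (norm_nonneg _) zero_le_one, EuclideanSpace.real_norm_sq_eq]
  simp [unitOnes, hn'.ne']

/-- The sample with mean `μ + n^(-1/2) A y` and centred data `c Aᵗ`. -/
noncomputable def sampleOf {n p : ℕ} {ι : Type*} [Fintype ι] (μ : EuclideanSpace ℝ (Fin p))
    (A : Matrix (Fin p) ι ℝ) (ω : (ι → ℝ) × (ι → (ℝ ∙ unitOnes n)ᗮ)) : Sample n p :=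
  fun i => WithLp.toLp 2 fun k =>
    μ k + (A *ᵥ fun j => (ω.1 j • unitOnes n + (ω.2 j : EuclideanSpace ℝ (Fin n))) i) k

theorem measurable_sampleOf {n p : ℕ} {ι : Type*} [Fintype ι] (μ : EuclideanSpace ℝ (Fin p))
    (A : Matrix (Fin p) ι ℝ) : Measurable (sampleOf (n := n) μ A) := by
  unfold sampleOf
  simp only [Matrix.mulVec, dotProduct]
  fun_prop

/-- The transposed noise splits along `unitOnes n` and its complement, which separates the sample
mean from the centred data and makes them independent. -/
theorem sampleLaw_eq_map {n p r : ℕ} (hn : 0 < n) {ι : Type*} [Fintype ι] (θ : Param p r)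
    (A : Matrix (Fin p) ι ℝ) (hA : A * Aᵀ = θ.cov) :
    sampleLaw n θ = (stdPairLaw (ℝ ∙ unitOnes n)ᗮ ι).map (sampleOf θ.mean A) := by
  have hm : Measurable fun z : EuclideanSpace ℝ ι =>
      (WithLp.toLp 2 fun k => θ.mean k + (A *ᵥ z.ofLp) k : EuclideanSpace ℝ (Fin p)) := by
    simp only [Matrix.mulVec, dotProduct]
    fun_prop
  have : IsProbabilityMeasure ((stdGaussian (EuclideanSpace ℝ ι)).map (fun z =>
      (WithLp.toLp 2 fun k => θ.mean k + (A *ᵥ z.ofLp) k : EuclideanSpace ℝ (Fin p)))) :=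
    Measure.isProbabilityMeasure_map hm.aemeasurable
  rw [sampleLaw, ← hA]
  simp_rw [multivariateGaussian_eq_map]
  rw [← Measure.pi_map_pi (fun _ => hm.aemeasurable), ← pi_stdGaussian_map_swap,
    pi_stdGaussian_eq_map_stdPairLaw (norm_unitOnes hn),
    Measure.map_map (by fun_prop) (by fun_prop), Measure.map_map (by fun_prop) (by fun_prop)]
  rfl

/-! ### The pseudoinverse of `A G Aᵗ` -/

theorem pinv_eq_of_isMoorePenrose {m n : Type*} [Fintype m] [Fintype n] {A : Matrix m n ℝ}
    {B : Matrix n m ℝ} (h : IsMoorePenrose A B) : pinv A = B :=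
  (isMoorePenrose_pinv A).unique h

theorem isMoorePenrose_smul {m n : Type*} [Fintype m] [Fintype n] {A : Matrix m n ℝ}
    {B : Matrix n m ℝ} (h : IsMoorePenrose A B) {s : ℝ} (hs : s ≠ 0) :
    IsMoorePenrose (s • A) (s⁻¹ • B) where
  mul_mul_left := by simp [smul_smul, h.mul_mul_left, hs]
  mul_mul_right := by simp [smul_smul, h.mul_mul_right, hs]
  symm_left := by simp [smul_smul, hs, -Matrix.transpose_mul, h.symm_left]
  symm_right := by simp [smul_smul, hs, -Matrix.transpose_mul, h.symm_right]

section
variable {κ ι : Type*} [Fintype κ] [Fintype ι] [DecidableEq ι] {A : Matrix κ ι ℝ} {d : ι → ℝ}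

open Matrix in
theorem diagonal_inv_mul_transpose_mul (hA : Aᵀ * A = diagonal d) (hd : ∀ i, 0 < d i) :
    diagonal d⁻¹ * (Aᵀ * A) = 1 := by
  rw [hA, diagonal_mul_diagonal, ← diagonal_one]
  congr 1
  funext i
  simp [(hd i).ne']

open Matrix in
theorem transpose_mul_mul_diagonal_inv (hA : Aᵀ * A = diagonal d) (hd : ∀ i, 0 < d i) :
    Aᵀ * A * diagonal d⁻¹ = 1 := by
  rw [hA, diagonal_mul_diagonal, ← diagonal_one]
  congr 1
  funext i
  simp [(hd i).ne']

open Matrix in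
-- Both products of the two matrices collapse to `A D⁻¹ Aᵗ`, the orthogonal projection onto the
-- column space of `A`, whatever the invertible `G`.
theorem isMoorePenrose_mul_mul_transpose (hA : Aᵀ * A = diagonal d) (hd : ∀ i, 0 < d i)
    {G : Matrix ι ι ℝ} (hG : IsUnit G.det) :
    IsMoorePenrose (A * G * Aᵀ)
      (A * diagonal d⁻¹ * G⁻¹ * diagonal d⁻¹ * Aᵀ) := by
  have h1 := diagonal_inv_mul_transpose_mul hA hd
  have h2 := transpose_mul_mul_diagonal_inv hA hd
  have hl : (A * G * Aᵀ) * (A * diagonal d⁻¹ * G⁻¹ * diagonal d⁻¹ * Aᵀ) =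
      A * diagonal d⁻¹ * Aᵀ := by
    calc _ = A * (G * ((Aᵀ * A * diagonal d⁻¹) * G⁻¹)) * diagonal d⁻¹ * Aᵀ := by
          simp only [Matrix.mul_assoc]
      _ = _ := by rw [h2, Matrix.one_mul, mul_nonsing_inv _ hG, Matrix.mul_one]
  have hr : (A * diagonal d⁻¹ * G⁻¹ * diagonal d⁻¹ * Aᵀ) * (A * G * Aᵀ) =
      A * diagonal d⁻¹ * Aᵀ := by
    calc _ = A * diagonal d⁻¹ * (G⁻¹ * ((diagonal d⁻¹ * (Aᵀ * A)) * G)) * Aᵀ := by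
          simp only [Matrix.mul_assoc]
      _ = _ := by rw [h1, Matrix.one_mul, nonsing_inv_mul _ hG, Matrix.mul_one]
  have hs : (A * diagonal d⁻¹ * Aᵀ)ᵀ = A * diagonal d⁻¹ * Aᵀ := by
    simp [transpose_mul, Matrix.mul_assoc]
  refine ⟨?_, ?_, ?_, ?_⟩
  · rw [hl]
    calc _ = A * (diagonal d⁻¹ * (Aᵀ * A)) * G * Aᵀ := by simp only [Matrix.mul_assoc]
      _ = _ := by rw [h1, Matrix.mul_one]
  · rw [hr]
    calc _ = A * (diagonal d⁻¹ * (Aᵀ * A)) * diagonal d⁻¹ * G⁻¹ * diagonal d⁻¹ * Aᵀ := by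
          simp only [Matrix.mul_assoc]
      _ = _ := by rw [h1, Matrix.mul_one]
  · rw [hl, hs]
  · rw [hr, hs]

open Matrix in
-- Orthogonality of the columns of `A` removes the cross terms, so the loss will be a sum over
-- single coordinates.
theorem norm_sq_mul_diagonal_inv_mulVec (hA : Aᵀ * A = diagonal d) (hd : ∀ i, 0 < d i)
    (w : ι → ℝ) :
    ‖(WithLp.toLp 2 ((A * diagonal d⁻¹) *ᵥ w) : EuclideanSpace ℝ κ)‖ ^ 2 =
      ∑ j, (d j)⁻¹ * w j ^ 2 := by
  rw [← real_inner_self_eq_norm_sq, EuclideanSpace.inner_eq_star_dotProduct, star_trivial]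
  show (A * diagonal d⁻¹) *ᵥ w ⬝ᵥ (A * diagonal d⁻¹) *ᵥ w = _
  have h : (A * diagonal d⁻¹)ᵀ * (A * diagonal d⁻¹) = diagonal d⁻¹ := by
    calc _ = diagonal d⁻¹ * (Aᵀ * A * diagonal d⁻¹) := by
          simp [transpose_mul, Matrix.mul_assoc]
      _ = _ := by rw [transpose_mul_mul_diagonal_inv hA hd, Matrix.mul_one]
  rw [dotProduct_mulVec, ← mulVec_transpose, mulVec_mulVec, h]
  simp only [dotProduct, mulVec_diagonal, Pi.inv_apply]
  refine Finset.sum_congr rfl fun j _ => ?_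
  ring

end

/-! ### Sample mean, covariance, loss and quadratic form in these coordinates -/

section
variable {n p : ℕ} {ι : Type*} [Fintype ι]

theorem inner_unitOnes (v : EuclideanSpace ℝ (Fin n)) :
    inner ℝ (unitOnes n) v = (√n)⁻¹ * ∑ i, v i := by
  rw [EuclideanSpace.inner_eq_star_dotProduct]
  rw [Finset.mul_sum]
  simp [unitOnes, dotProduct, mul_comm]

theorem sum_coe_orthogonal_unitOnes (hn : 0 < n) (c : (ℝ ∙ unitOnes n)ᗮ) :
    ∑ i, (c : EuclideanSpace ℝ (Fin n)) i = 0 := by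
  have h := (Submodule.mem_orthogonal_singleton_iff_inner_right).mp c.2
  rw [inner_unitOnes] at h
  have hn' : (0 : ℝ) < n := by exact_mod_cast hn
  exact (mul_eq_zero.mp h).resolve_left (by positivity)

theorem sampleMean_sampleOf_apply (hn : 0 < n) (μ : EuclideanSpace ℝ (Fin p))
    (A : Matrix (Fin p) ι ℝ) (ω : (ι → ℝ) × (ι → (ℝ ∙ unitOnes n)ᗮ)) (k : Fin p) :
    sampleMean (sampleOf μ A ω) k = μ k + (A *ᵥ fun j => (√n)⁻¹ * ω.1 j) k := by
  have hn' : (n : ℝ) ≠ 0 := by exact_mod_cast hn.ne'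
  have h1 : ∀ j, ∑ i, (ω.1 j • unitOnes n + (ω.2 j : EuclideanSpace ℝ (Fin n))) i =
      n * ((√n)⁻¹ * ω.1 j) := by
    intro j
    simp only [PiLp.add_apply, PiLp.smul_apply, Finset.sum_add_distrib,
      sum_coe_orthogonal_unitOnes hn]
    simp [unitOnes, mul_comm]
  simp only [sampleMean, PiLp.smul_apply, WithLp.ofLp_sum, Finset.sum_apply, sampleOf,
    Finset.sum_add_distrib, Matrix.mulVec, dotProduct, smul_eq_mul]
  rw [Finset.sum_comm]
  simp only [← Finset.mul_sum]
  rw [mul_add]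
  congr 1
  · simp [hn']
  · rw [Finset.mul_sum]
    refine Finset.sum_congr rfl fun j _ => ?_
    rw [h1 j]
    field_simp

theorem centredData_sampleOf (hn : 0 < n) (μ : EuclideanSpace ℝ (Fin p))
    (A : Matrix (Fin p) ι ℝ) (ω : (ι → ℝ) × (ι → (ℝ ∙ unitOnes n)ᗮ)) :
    centredData (sampleOf μ A ω) =
      Matrix.of (fun i j => (ω.2 j : EuclideanSpace ℝ (Fin n)) i) * Aᵀ := by
  ext i k
  simp only [centredData, Matrix.of_apply, sampleMean_sampleOf_apply hn]
  simp only [sampleOf, Matrix.mul_apply, Matrix.mulVec, dotProduct, Matrix.of_apply,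
    Matrix.transpose_apply, PiLp.add_apply, PiLp.smul_apply]
  rw [add_sub_add_left_eq_sub, ← Finset.sum_sub_distrib]
  refine Finset.sum_congr rfl fun j _ => ?_
  simp [unitOnes]
  ring

open Matrix in
theorem sampleCov_sampleOf (hn : 0 < n) (μ : EuclideanSpace ℝ (Fin p))
    (A : Matrix (Fin p) ι ℝ) (ω : (ι → ℝ) × (ι → (ℝ ∙ unitOnes n)ᗮ)) :
    sampleCov (sampleOf μ A ω) = (n : ℝ)⁻¹ • (A * gram ℝ ω.2 * Aᵀ) := by
  have hV : (Matrix.of fun i j => (ω.2 j : EuclideanSpace ℝ (Fin n)) i)ᵀ *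
      (Matrix.of fun i j => (ω.2 j : EuclideanSpace ℝ (Fin n)) i) = gram ℝ ω.2 := by
    ext j k
    rw [gram_apply, Submodule.coe_inner, EuclideanSpace.inner_eq_star_dotProduct]
    simp [mul_apply, dotProduct, mul_comm]
  rw [sampleCov, centredData_sampleOf hn, transpose_mul, transpose_transpose, ← hV]
  simp only [Matrix.mul_assoc]

variable [DecidableEq ι] {A : Matrix (Fin p) ι ℝ} {d : ι → ℝ}

open Matrix in
theorem pinv_sampleCov_sampleOf (hn : 0 < n) (hA : Aᵀ * A = diagonal d) (hd : ∀ i, 0 < d i)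
    (μ : EuclideanSpace ℝ (Fin p)) {ω : (ι → ℝ) × (ι → (ℝ ∙ unitOnes n)ᗮ)}
    (hω : LinearIndependent ℝ ω.2) :
    pinv (sampleCov (sampleOf μ A ω)) =
      (n : ℝ) • (A * diagonal d⁻¹ * (gram ℝ ω.2)⁻¹ * diagonal d⁻¹ * Aᵀ) := by
  have hn' : (n : ℝ) ≠ 0 := by exact_mod_cast hn.ne'
  have hdet : IsUnit (gram ℝ ω.2).det :=
    isUnit_iff_ne_zero.mpr (det_gram_ne_zero_iff_linearIndependent.mpr hω)
  have h := isMoorePenrose_smul (isMoorePenrose_mul_mul_transpose hA hd hdet)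
    (inv_ne_zero hn')
  rw [inv_inv] at h
  rw [sampleCov_sampleOf hn]
  exact pinv_eq_of_isMoorePenrose h

open Matrix in
theorem pinv_sampleCov_mulVec_sampleMean (hn : 0 < n) (hA : Aᵀ * A = diagonal d)
    (hd : ∀ i, 0 < d i) (μ : EuclideanSpace ℝ (Fin p))
    {ω : (ι → ℝ) × (ι → (ℝ ∙ unitOnes n)ᗮ)} (hω : LinearIndependent ℝ ω.2) :
    pinv (sampleCov (sampleOf μ A ω)) *ᵥ (sampleMean (sampleOf μ A ω)).ofLp =
      (n : ℝ) • ((A * diagonal d⁻¹) *ᵥ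
        gramSolve ((diagonal d⁻¹ * Aᵀ) *ᵥ μ.ofLp) (√n)⁻¹ ω) := by
  have hm : (sampleMean (sampleOf μ A ω)).ofLp =
      μ.ofLp + A *ᵥ fun j => (√n)⁻¹ * ω.1 j := by
    funext k
    exact sampleMean_sampleOf_apply hn μ A ω k
  -- `D⁻¹ Aᵗ` is a left inverse of `A`, so it sends the sample mean to `ν + n^(-1/2) y`.
  have hg : (gramSolve ((diagonal d⁻¹ * Aᵀ) *ᵥ μ.ofLp) (√n)⁻¹ ω) =
      (gram ℝ ω.2)⁻¹ *ᵥ ((diagonal d⁻¹ * Aᵀ) *ᵥ (sampleMean (sampleOf μ A ω)).ofLp) := by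
    rw [hm, mulVec_add (diagonal d⁻¹ * Aᵀ), mulVec_mulVec _ _ A, Matrix.mul_assoc _ _ A,
      diagonal_inv_mul_transpose_mul hA hd, one_mulVec]
    rfl
  rw [pinv_sampleCov_sampleOf hn hA hd μ hω, hg, smul_mulVec, mulVec_mulVec, mulVec_mulVec]
  simp only [Matrix.mul_assoc]

open Matrix in
theorem discCoef_eq {r : ℕ} (θ : Param p r) (hcov : A * Aᵀ = θ.cov) (hA : Aᵀ * A = diagonal d)
    (hd : ∀ i, 0 < d i) :
    discCoef θ = WithLp.toLp 2
      ((A * diagonal d⁻¹) *ᵥ ((diagonal d⁻¹ * Aᵀ) *ᵥ θ.mean.ofLp)) := by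
  -- With `G = 1` the matrix `A G Aᵗ` is the covariance itself.
  have h := isMoorePenrose_mul_mul_transpose (G := 1) hA hd (by simp)
  rw [Matrix.mul_one, hcov, inv_one, Matrix.mul_one] at h
  rw [discCoef, pinv_eq_of_isMoorePenrose h, mulVec_mulVec]
  simp only [Matrix.mul_assoc]

open Matrix in
theorem sqLoss_scaledEstimator_sampleOf {r : ℕ} (hn : 0 < n) (θ : Param p r)
    (hcov : A * Aᵀ = θ.cov) (hA : Aᵀ * A = diagonal d) (hd : ∀ i, 0 < d i) (a : ℝ)
    {ω : (ι → ℝ) × (ι → (ℝ ∙ unitOnes n)ᗮ)} (hω : LinearIndependent ℝ ω.2) :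
    sqLoss (scaledEstimator a) θ (sampleOf θ.mean A ω) =
      ∑ j, (d j)⁻¹ * (a * n * gramSolve ((diagonal d⁻¹ * Aᵀ) *ᵥ θ.mean.ofLp) (√n)⁻¹ ω j -
        ((diagonal d⁻¹ * Aᵀ) *ᵥ θ.mean.ofLp) j) ^ 2 := by
  set ν := (diagonal d⁻¹ * Aᵀ) *ᵥ θ.mean.ofLp with hν
  rw [sqLoss, scaledEstimator, pinv_sampleCov_mulVec_sampleMean hn hA hd θ.mean hω,
    discCoef_eq θ hcov hA hd, ← WithLp.toLp_smul, ← WithLp.toLp_sub, smul_smul, ← hν,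
    ← mulVec_smul, ← mulVec_sub, norm_sq_mul_diagonal_inv_mulVec hA hd]
  rfl

open Matrix in
theorem quadForm_sampleOf (hn : 0 < n) (hA : Aᵀ * A = diagonal d) (hd : ∀ i, 0 < d i)
    (μ : EuclideanSpace ℝ (Fin p)) {ω : (ι → ℝ) × (ι → (ℝ ∙ unitOnes n)ᗮ)}
    (hω : LinearIndependent ℝ ω.2) :
    quadForm (sampleOf μ A ω) = (n : ℝ) ^ 2 *
      ∑ j, (d j)⁻¹ * gramSolve ((diagonal d⁻¹ * Aᵀ) *ᵥ μ.ofLp) (√n)⁻¹ ω j ^ 2 := by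
  have hsymm : (pinv (sampleCov (sampleOf μ A ω)))ᵀ = pinv (sampleCov (sampleOf μ A ω)) := by
    have hV : (gram ℝ ω.2)ᵀ = gram ℝ ω.2 := by
      have := isHermitian_gram ℝ ω.2
      rwa [IsHermitian, conjTranspose_eq_transpose_of_trivial] at this
    rw [pinv_sampleCov_sampleOf hn hA hd μ hω]
    simp [transpose_mul, Matrix.mul_assoc, transpose_nonsing_inv, hV]
  have h : quadForm (sampleOf μ A ω) = ‖(WithLp.toLp 2 (pinv (sampleCov (sampleOf μ A ω)) *ᵥ
      (sampleMean (sampleOf μ A ω)).ofLp) : EuclideanSpace ℝ (Fin p))‖ ^ 2 := by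
    rw [quadForm, ← real_inner_self_eq_norm_sq, EuclideanSpace.inner_eq_star_dotProduct,
      star_trivial, pow_two, ← mulVec_mulVec, dotProduct_mulVec, ← mulVec_transpose, hsymm]
  rw [h, pinv_sampleCov_mulVec_sampleMean hn hA hd μ hω, WithLp.toLp_smul, norm_smul, mul_pow,
    norm_sq_mul_diagonal_inv_mulVec hA hd, Real.norm_eq_abs, sq_abs]

theorem sampleOf_injective (hn : 0 < n) (hA : Aᵀ * A = Matrix.diagonal d) (hd : ∀ i, 0 < d i)
    (μ : EuclideanSpace ℝ (Fin p)) : Function.Injective (sampleOf (n := n) μ A) := by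
  intro ω ω' h
  have hinj : Function.Injective fun z : ι → ℝ => A *ᵥ z := by
    intro z z' hz
    have h1 : (Matrix.diagonal d⁻¹ * Aᵀ) *ᵥ (A *ᵥ z) = (Matrix.diagonal d⁻¹ * Aᵀ) *ᵥ (A *ᵥ z') :=
      congrArg _ hz
    rwa [Matrix.mulVec_mulVec, Matrix.mulVec_mulVec, Matrix.mul_assoc,
      diagonal_inv_mul_transpose_mul hA hd, Matrix.one_mulVec, Matrix.one_mulVec] at h1
  have hz : ∀ j, ω.1 j • unitOnes n + (ω.2 j : EuclideanSpace ℝ (Fin n)) =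
      ω'.1 j • unitOnes n + (ω'.2 j : EuclideanSpace ℝ (Fin n)) := by
    intro j
    ext i
    have h1 : (fun j => (ω.1 j • unitOnes n + (ω.2 j : EuclideanSpace ℝ (Fin n))) i) =
        fun j => (ω'.1 j • unitOnes n + (ω'.2 j : EuclideanSpace ℝ (Fin n))) i := by
      apply hinj
      funext k
      have h2 : sampleOf μ A ω i k = sampleOf μ A ω' i k := by rw [h]
      simpa [sampleOf] using h2
    exact congrFun h1 j
  have hy : ∀ j, ω.1 j = ω'.1 j := by
    intro j
    have h1 := congrArg (fun v => inner ℝ (unitOnes n) v) (hz j)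
    simpa [inner_add_right, inner_smul_right, norm_unitOnes hn,
      (Submodule.mem_orthogonal_singleton_iff_inner_right).mp (ω.2 j).2,
      (Submodule.mem_orthogonal_singleton_iff_inner_right).mp (ω'.2 j).2] using h1
  refine Prod.ext (funext hy) (funext fun j => Subtype.ext ?_)
  have h1 := hz j
  rw [hy j] at h1
  exact add_left_cancel h1

/-- The samples are injectively parametrised, so integrals transfer without measurability
of the pseudoinverse. -/
theorem measurableEmbedding_sampleOf (hn : 0 < n) (hA : Aᵀ * A = Matrix.diagonal d)
    (hd : ∀ i, 0 < d i) (μ : EuclideanSpace ℝ (Fin p)) :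
    MeasurableEmbedding (sampleOf (n := n) μ A) :=
  (measurable_sampleOf μ A).measurableEmbedding (sampleOf_injective hn hA hd μ)

end

/-! ### The risk as a quadratic polynomial -/

open Matrix in
/-- A full rank factorisation of a covariance matrix, with orthogonal columns. -/
theorem exists_mul_transpose_eq_cov {p r : ℕ} (θ : Param p r) :
    ∃ (A : Matrix (Fin p) (Fin r) ℝ) (d : Fin r → ℝ),
      A * Aᵀ = θ.cov ∧ Aᵀ * A = diagonal d ∧ ∀ i, 0 < d i := by
  have hG := θ.posSemidef.isHermitian
  obtain ⟨U, l, hl, hU, hGU, hcard⟩ : ∃ (U : Matrix (Fin p) (Fin p) ℝ) (l : Fin p → ℝ),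
      (∀ i, 0 ≤ l i) ∧ Uᵀ * U = 1 ∧ θ.cov = U * diagonal l * Uᵀ ∧
        Fintype.card {i // l i ≠ 0} = r := by
    refine ⟨hG.eigenvectorUnitary, hG.eigenvalues, θ.posSemidef.eigenvalues_nonneg, ?_, ?_, ?_⟩
    · have := Unitary.coe_star_mul_self hG.eigenvectorUnitary
      rwa [star_eq_conjTranspose, conjTranspose_eq_transpose_of_trivial] at this
    · have := hG.spectral_theorem
      rw [Unitary.conjStarAlgAut_apply, star_eq_conjTranspose,
        conjTranspose_eq_transpose_of_trivial] at this
      simpa [Function.comp_def] using this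
    · rw [← hG.rank_eq_card_non_zero_eigs, θ.rank_eq]
  let e := Fintype.equivFinOfCardEq hcard
  -- The columns of `A` are the unit eigenvectors with non-zero eigenvalue, scaled by the square
  -- root of that eigenvalue. The others contribute nothing to `A Aᵗ`.
  refine ⟨of fun k j => U k (e.symm j) * √(l (e.symm j)), fun j => l (e.symm j), ?_, ?_, ?_⟩
  · ext k m
    rw [hGU]
    simp only [mul_apply, of_apply, transpose_apply, diagonal_apply, mul_ite, mul_zero,
      Finset.sum_ite_eq', Finset.mem_univ, if_true]
    rw [e.symm.sum_comp (fun i : {i // l i ≠ 0} => U k i * √(l i) * (U m i * √(l i)))]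
    rw [← Finset.sum_subtype (Finset.univ.filter fun i => l i ≠ 0) (by simp)
      (fun i => U k i * √(l i) * (U m i * √(l i))), Finset.sum_filter_of_ne]
    · refine Finset.sum_congr rfl fun i _ => ?_
      rw [mul_mul_mul_comm, Real.mul_self_sqrt (hl i)]
      ring
    · intro i _ hi h0
      simp [h0] at hi
  · ext i j
    have hij := congrFun (congrFun hU (e.symm i)) (e.symm j)
    simp only [mul_apply, transpose_apply] at hij
    simp only [mul_apply, of_apply, transpose_apply]
    calc _ = √(l (e.symm i)) * √(l (e.symm j)) *
          ∑ k, U k (e.symm i) * U k (e.symm j) := by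
            rw [Finset.mul_sum]
            exact Finset.sum_congr rfl fun k _ => by ring
      _ = _ := by
        rw [hij]
        rcases eq_or_ne i j with rfl | h
        · simp [Real.mul_self_sqrt (hl _)]
        · have h' : ((e.symm i : {i // l i ≠ 0}) : Fin p) ≠ (e.symm j) := fun h' =>
            h (e.symm.injective (Subtype.ext h'))
          simp [h, h']
  · exact fun j => lt_of_le_of_ne (hl _) (Ne.symm (e.symm j).2)

theorem finrank_orthogonal_unitOnes {n : ℕ} (hn : 0 < n) :
    Module.finrank ℝ (ℝ ∙ unitOnes n)ᗮ + 1 = n := by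
  have h := Submodule.finrank_add_finrank_orthogonal (ℝ ∙ unitOnes n)
  have hne : unitOnes n ≠ 0 := fun h0 => by
    have := norm_unitOnes hn
    simp [h0] at this
  rw [finrank_span_singleton hne, finrank_euclideanSpace_fin] at h
  omega

/-- The risk of `a S⁺ X̄` is a quadratic polynomial in `a`, whose coefficients are compared
through the moments of an inverse Wishart matrix. -/
theorem exists_risk_scaledEstimator_eq {n p r : ℕ} (hr : 1 ≤ r) (hrn : r + 5 ≤ n)
    (θ : Param p r) :
    (∀ a : ℝ, Integrable (sqLoss (n := n) (scaledEstimator a) θ) (sampleLaw n θ)) ∧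
    Integrable (quadForm (n := n) (p := p)) (sampleLaw n θ) ∧
    ∃ s Q : ℝ, 0 ≤ s ∧ 0 < Q ∧ s / (((n : ℝ) - r - 2) * (n - r - 4)) ≤ Q ∧
      (∫ X, quadForm X ∂(sampleLaw n θ) = n ^ 2 * Q) ∧
      ∀ a : ℝ, risk (n := n) (scaledEstimator a) θ =
        (a * n) ^ 2 * Q - 2 * (a * n) * (s / ((n : ℝ) - r - 2)) + s := by
  have hn : 0 < n := by omega
  have hn' : (0 : ℝ) < n := by exact_mod_cast hn
  obtain ⟨A, d, hcov, hA, hd⟩ := exists_mul_transpose_eq_cov θ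
  have hfin := finrank_orthogonal_unitOnes hn
  have hfinR : (Module.finrank ℝ (ℝ ∙ unitOnes n)ᗮ : ℝ) + 1 = n := by exact_mod_cast hfin
  set P := stdPairLaw (ℝ ∙ unitOnes n)ᗮ (Fin r) with hP
  set ν := (Matrix.diagonal d⁻¹ * Aᵀ) *ᵥ θ.mean.ofLp with hν
  set τ := (√(n : ℝ))⁻¹ with hτ
  -- The complement of the diagonal has dimension `n - 1`, so this is exactly `r + 5 ≤ n`.
  have hdim : Fintype.card (Fin r) + 4 ≤ Module.finrank ℝ (ℝ ∙ unitOnes n)ᗮ := by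
    rw [Fintype.card_fin]; omega
  have hlaw := sampleLaw_eq_map hn θ A hcov
  have hli := ae_linearIndependent_stdPairLaw (E := (ℝ ∙ unitOnes n)ᗮ) (ι := Fin r) (by omega)
  have hL := memLp_gramSolve hdim ν τ
  have hloss : ∀ a, (fun ω => ∑ j, (d j)⁻¹ * (a * n * gramSolve ν τ ω j - ν j) ^ 2) =ᵐ[P]
      fun ω => sqLoss (scaledEstimator a) θ (sampleOf θ.mean A ω) := by
    intro a
    filter_upwards [hli] with ω hω
    exact (sqLoss_scaledEstimator_sampleOf hn θ hcov hA hd a hω).symm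
  have hquad : (fun ω => (n : ℝ) ^ 2 * ∑ j, (d j)⁻¹ * gramSolve ν τ ω j ^ 2) =ᵐ[P]
      fun ω => quadForm (sampleOf θ.mean A ω) := by
    filter_upwards [hli] with ω hω
    exact (quadForm_sampleOf hn hA hd θ.mean hω).symm
  have hemb := measurableEmbedding_sampleOf (n := n) hn hA hd θ.mean
  have hI1 : ∀ j, Integrable (fun ω => gramSolve ν τ ω j) P := fun j =>
    (hL j).integrable (by norm_num)
  have hI2 : ∀ j, Integrable (fun ω => gramSolve ν τ ω j ^ 2) P := fun j => (hL j).integrable_sq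
  have hexp : ∀ (a : ℝ) j, (fun ω : (Fin r → ℝ) × (Fin r → (ℝ ∙ unitOnes n)ᗮ) => (d j)⁻¹ * (a * n * gramSolve ν τ ω j - ν j) ^ 2) =
      fun ω => (d j)⁻¹ * ((a * n) ^ 2 * gramSolve ν τ ω j ^ 2 -
        2 * (a * n) * ν j * gramSolve ν τ ω j + ν j ^ 2) := by
    intro a j
    funext ω
    ring
  have hIa : ∀ a j, Integrable (fun ω => (d j)⁻¹ * (a * n * gramSolve ν τ ω j - ν j) ^ 2) P := by
    intro a j
    rw [hexp]
    exact ((((hI2 j).const_mul _).sub ((hI1 j).const_mul _)).add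
      (integrable_const _)).const_mul _
  have hF1 : (Module.finrank ℝ (ℝ ∙ unitOnes n)ᗮ : ℝ) - Fintype.card (Fin r) - 1 = n - r - 2 := by
    rw [Fintype.card_fin]; linarith
  have hF3 : (Module.finrank ℝ (ℝ ∙ unitOnes n)ᗮ : ℝ) - Fintype.card (Fin r) - 3 = n - r - 4 := by
    rw [Fintype.card_fin]; linarith
  have hM1 := integral_gramSolve hdim ν τ
  have hM2 := le_integral_gramSolve_sq hdim ν τ
  simp only [hF1, hF3] at hM1 hM2
  -- For `r = 0` the sum defining `Q` would be empty, so `0 < Q` depends on `1 ≤ r`.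
  have : Nonempty (Fin r) := ⟨⟨0, hr⟩⟩
  -- Here `s` is `‖η‖²` and `n² Q` is the expectation of the quadratic form.
  refine ⟨fun a => ?_, ?_, ∑ j, (d j)⁻¹ * ν j ^ 2,
    ∑ j, (d j)⁻¹ * ∫ ω, gramSolve ν τ ω j ^ 2 ∂P, ?_, ?_, ?_, ?_, fun a => ?_⟩
  · rw [hlaw, hemb.integrable_map_iff]
    exact (integrable_finsetSum _ fun j _ => hIa a j).congr (hloss a)
  · rw [hlaw, hemb.integrable_map_iff]
    exact ((integrable_finsetSum _ fun j _ => (hI2 j).const_mul _).const_mul _).congr hquad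
  · exact Finset.sum_nonneg fun j _ => mul_nonneg (inv_nonneg.mpr (hd j).le) (sq_nonneg _)
  · exact integral_sum_gramSolve_sq_pos hdim ν (inv_ne_zero (by positivity))
      fun j => inv_pos.mpr (hd j)
  · rw [Finset.sum_div]
    refine Finset.sum_le_sum fun j _ => ?_
    rw [mul_div_assoc, ← mul_one_div (ν j ^ 2)]
    exact mul_le_mul_of_nonneg_left (hM2 j) (inv_nonneg.mpr (hd j).le)
  · rw [hlaw, hemb.integral_map, ← integral_congr_ae hquad, integral_const_mul,
      integral_finsetSum _ fun j _ => (hI2 j).const_mul _]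
    simp_rw [integral_const_mul]
  · rw [risk, hlaw, hemb.integral_map, ← integral_congr_ae (hloss a),
      integral_finsetSum _ fun j _ => hIa a j, Finset.mul_sum, Finset.sum_div, Finset.mul_sum,
      ← Finset.sum_sub_distrib, ← Finset.sum_add_distrib]
    refine Finset.sum_congr rfl fun j _ => ?_
    have i1 := (hI2 j).const_mul ((a * n) ^ 2)
    have i2 := (hI1 j).const_mul (2 * (a * n) * ν j)
    have i12 : Integrable (fun ω => (a * n) ^ 2 * gramSolve ν τ ω j ^ 2 -
      2 * (a * n) * ν j * gramSolve ν τ ω j) P := i1.sub i2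
    rw [hexp, integral_const_mul, integral_add i12 (integrable_const _), integral_sub i1 i2,
      integral_const_mul, integral_const_mul, hM1 j]
    simp
    ring

/-! ### The risk bound and the dominations -/

theorem nonempty_param {p r : ℕ} (hrp : r ≤ p) : Nonempty (Param p r) := by
  refine ⟨⟨0, Matrix.diagonal fun i => if (i : ℕ) < r then 1 else 0, ?_, ?_⟩⟩
  · exact Matrix.PosSemidef.diagonal fun i => by
      show (0 : ℝ) ≤ if (i : ℕ) < r then 1 else 0
      split_ifs <;> norm_num
  · rw [Matrix.rank_diagonal]
    simp only [ne_eq, ite_eq_right_iff, one_ne_zero, imp_false, not_not]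
    rw [Fintype.card_subtype, Fin.card_filter_val_lt]
    omega

theorem dominates_of_forall_lt {n p r : ℕ} (hrp : r ≤ p)
    {δ₁ δ₂ : Sample n p → EuclideanSpace ℝ (Fin p)}
    (h : ∀ θ : Param p r, risk δ₁ θ < risk δ₂ θ) : Dominates r δ₁ δ₂ :=
  ⟨fun θ => (h θ).le, (nonempty_param hrp).elim fun θ => ⟨θ, h θ⟩⟩

theorem proposition5 (n p r : ℕ) (hr : 1 ≤ r) (hrn : r + 5 ≤ n) (hrp : r < p) :
    (∀ θ : Param p r,
      (∀ a : ℝ, Integrable (sqLoss (n := n) (scaledEstimator a) θ) (sampleLaw n θ)) ∧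
      Integrable (quadForm (n := n) (p := p)) (sampleLaw n θ) ∧
      (∀ a : ℝ, a ≤ ((n : ℝ) - r - 2) / n →
        risk (n := n) (scaledEstimator a) θ ≤ riskBound n θ a) ∧
      (∀ a : ℝ, a ≠ ((n : ℝ) - r - 3) / n →
        riskBound n θ (((n : ℝ) - r - 3) / n) < riskBound n θ a)) ∧
    Dominates (n := n) (p := p) r (scaledEstimator (((n : ℝ) - r - 3) / n))
      (scaledEstimator (((n : ℝ) - r - 2) / n)) ∧
    Dominates (n := n) (p := p) r (scaledEstimator (((n : ℝ) - r - 2) / n))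
      (scaledEstimator 1) := by
  have hn : (0 : ℝ) < n := by exact_mod_cast (by omega : 0 < n)
  have hr' : (1 : ℝ) ≤ r := by exact_mod_cast hr
  have hk : (3 : ℝ) ≤ (n : ℝ) - r - 2 := by
    have : (r : ℝ) + 5 ≤ n := by exact_mod_cast hrn
    linarith
  set k : ℝ := (n : ℝ) - r - 2 with hkdef
  rw [show (n : ℝ) - r - 3 = k - 1 by rw [hkdef]; ring]
  have key : ∀ θ : Param p r, ∃ Q L s : ℝ, 0 < Q ∧ L ≤ (k - 1) * Q ∧
      (∫ X, quadForm X ∂(sampleLaw n θ) = n ^ 2 * Q) ∧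
      ∀ a : ℝ, risk (n := n) (scaledEstimator a) θ =
        (a * n) ^ 2 * Q - 2 * (a * n) * L + s := by
    intro θ
    obtain ⟨-, -, s, Q, hs, hQ, hsQ, hquad, hrisk⟩ := exists_risk_scaledEstimator_eq hr hrn θ
    rw [← hkdef, show (n : ℝ) - r - 4 = k - 2 by rw [hkdef]; ring] at hsQ
    -- The moments give `L ≤ (k - 2) Q`; the weaker bound with `k - 1` is all that is used.
    refine ⟨Q, s / k, s, hQ, ?_, hquad, hrisk⟩
    have h2 : 0 < k - 2 := by linarith
    have h3 : s / k ≤ (k - 2) * Q := by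
      rw [← div_div, div_le_iff₀ h2] at hsQ
      linarith
    linarith [h3, hQ]
  have hbound : ∀ θ : Param p r, ∀ a : ℝ, riskBound n θ a =
      risk (n := n) (scaledEstimator (k / n)) θ +
        (a * n - k) * (a * n - (k - 2)) / n ^ 2 * ∫ X, quadForm X ∂(sampleLaw n θ) := by
    intro θ a
    rw [riskBound, ← hkdef, show (n : ℝ) - r - 4 = k - 2 by rw [hkdef]; ring]
    congr 2
    field_simp
  have hcancel : ∀ x Q : ℝ, x / n ^ 2 * (n ^ 2 * Q) = x * Q := fun x Q => by
    field_simp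
  refine ⟨fun θ => ?_, dominates_of_forall_lt hrp.le fun θ => ?_,
    dominates_of_forall_lt hrp.le fun θ => ?_⟩
  · obtain ⟨h1, h2, -⟩ := exists_risk_scaledEstimator_eq hr hrn θ
    obtain ⟨Q, L, s, hQ, hL, hquad, hrisk⟩ := key θ
    refine ⟨h1, h2, fun a ha => ?_, fun a ha => ?_⟩
    · have ha' : a * n ≤ k := (le_div_iff₀ hn).mp ha
      rw [hbound, hquad, hrisk, hrisk, div_mul_cancel₀ _ hn.ne', hcancel]
      -- The bound minus the risk is `2 (k - an) ((k - 1) Q - L)`.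
      nlinarith [mul_nonneg (sub_nonneg.mpr ha') (sub_nonneg.mpr hL)]
    · have ha' : a * n - (k - 1) ≠ 0 := fun h => ha (by rw [eq_div_iff hn.ne']; linarith)
      have hpos : 0 < (a * n - (k - 1)) ^ 2 := by positivity
      rw [hbound, hbound, hquad, div_mul_cancel₀ _ hn.ne', hcancel, hcancel]
      -- Completing the square: `(an - k)(an - (k - 2)) = (an - (k - 1))² - 1`.
      nlinarith [mul_pos hpos hQ]
  · obtain ⟨Q, L, s, hQ, hL, hquad, hrisk⟩ := key θ
    rw [hrisk, hrisk, div_mul_cancel₀ _ hn.ne', div_mul_cancel₀ _ hn.ne']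
    -- The difference of the risks is `(2k - 1) Q - 2L ≥ Q > 0`.
    nlinarith
  · obtain ⟨Q, L, s, hQ, hL, hquad, hrisk⟩ := key θ
    have hkn : k < n := by rw [hkdef]; linarith
    rw [hrisk, hrisk, div_mul_cancel₀ _ hn.ne', one_mul]
    -- The difference of the risks is this quantity times `n - k`; it is positive because `2L ≤ (2k
    -- - 2) Q` and `k < n`.
    have h1 : 0 < (n + k) * Q - 2 * L := by nlinarith
    nlinarith [mul_pos (sub_pos.mpr hkn) h1]
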